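/- **Theorem A.6.** Let $\mathcal B$ be a $C^*$-algebra of bounded operators acting irreducibly on a complex Hilbert space $\mathcal H$, let $G$ be a compact (Hausdorff) group and $U$ a strongly continuous unitary representation of $G$ on $\mathcal H$ inducing an action $\alpha$ of $G$ on $\mathcal B$; that is, $\alpha_g(B)=U(g)BU(g)^*\in\mathcal B$ for all $g\in G$, $B\in\mathcal B$, and $g\mapsto\alpha_g(B)$ is norm continuous for each $B\in\mathcal B$. A *Hilbert space in* $\mathcal B$ is a norm-closed linear subspace $E\subset\mathcal B$ such that $\psi^*\varphi\in\mathbb C I$ for all $\psi,\varphi\in E$, with inner product given by $\langle\psi,\varphi\rangle I=\psi^*\varphi$. Suppose that $\alpha$ has *full Hilbert spectrum*: every irreducible continuous unitary representation of $G$ is unitarily equivalent to the restriction of $\alpha$ to some $\alpha$-invariant Hilbert space in $\mathcal B$. Let $\mathcal B^G=\{B\in\mathcal B:\alpha_g(B)=B\ \text{for all } g\in G\}$ be the fixed-point algebra. Call a representation $\pi$ (a $*$-homomorphism of $\mathcal B$ into the bounded operators on a Hilbert space $\mathcal H_\pi$) *normal* on a $C^*$-subalgebra $\mathcal A\subset\mathcal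 B$ if $\pi|_{\mathcal A}$ is continuous for the ultraweak ($\sigma$-weak) topologies of $B(\mathcal H)$ and $B(\mathcal H_\pi)$. Then every representation $\pi$ of $\mathcal B$ that is normal on $\mathcal B^G$ is normal on $\mathcal B$. -/

import Mathlib

noncomputable section

section OperatorAlgebras

variable {H : Type*} [NormedAddCommGroup H] [InnerProductSpace ℂ H] [CompleteSpace H]

/-- A set of bounded operators acts irreducibly on the (nonzero) Hilbert space `H`: its only closed
invariant subspaces are `0` and `H`. -/
def ActsIrreducibly (S : Set (H →L[ℂ] H)) : Prop :=
  Nontrivial H ∧ ∀ M : Submodule ℂ H, IsClosed (M : Set H) →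
    (∀ T ∈ S, ∀ x ∈ M, T x ∈ M) → M = ⊥ ∨ M = ⊤

variable (H) in
/-- The ultraweak (σ-weak) topology on `B(H)`: the coarsest topology for which all functionals
`T ↦ ∑ₙ ⟪xₙ, T yₙ⟫`, with square-summable sequences of vectors `x` and `y`, are continuous. -/
abbrev ultraweakTopology : TopologicalSpace (H →L[ℂ] H) :=
  ⨅ (x : lp (fun _ : ℕ => H) 2) (y : lp (fun _ : ℕ => H) 2),
    TopologicalSpace.induced (fun T : H →L[ℂ] H => ∑' n, inner ℂ (x n) (T (y n))) inferInstance

/-- The representation `π` of the operator algebra `B` is normal on the subalgebra `A`: its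
restriction to the elements of `A` is continuous for the ultraweak topologies of `B(H)` and `B(K)`.
It is applied to `A ≤ B`. -/
def IsNormalOn {K : Type*} [NormedAddCommGroup K] [InnerProductSpace ℂ K] [CompleteSpace K]
    {B : NonUnitalStarSubalgebra ℂ (H →L[ℂ] H)} (π : B →⋆ₙₐ[ℂ] (K →L[ℂ] K))
    (A : NonUnitalStarSubalgebra ℂ (H →L[ℂ] H)) : Prop :=
  @Continuous {b : B // (b : H →L[ℂ] H) ∈ A} (K →L[ℂ] K)
    (TopologicalSpace.induced (fun b => ((b : B) : H →L[ℂ] H)) (ultraweakTopology H))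
    (ultraweakTopology K) (fun b => π b)

/-- A Hilbert space in `B`: a norm-closed linear subspace `E` of `B` such that `ψ* φ` is a scalar
for all `ψ, φ ∈ E` (this scalar is the inner product of `E`). -/
structure IsHilbertSpaceIn (B : NonUnitalStarSubalgebra ℂ (H →L[ℂ] H))
    (E : Submodule ℂ (H →L[ℂ] H)) : Prop where
  mem : ∀ ψ ∈ E, ψ ∈ B
  isClosed : IsClosed (E : Set (H →L[ℂ] H))
  scalar : ∀ ψ ∈ E, ∀ φ ∈ E, ∃ c : ℂ, star ψ * φ = c • (1 : H →L[ℂ] H)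

end OperatorAlgebras

section CompactGroupActions

variable {G : Type*} [Group G] [TopologicalSpace G]
  {H : Type*} [NormedAddCommGroup H] [InnerProductSpace ℂ H] [CompleteSpace H]

/-- Strong continuity of a unitary representation. -/
def IsContinuousUnitaryRep (U : G →* unitary (H →L[ℂ] H)) : Prop :=
  ∀ x : H, Continuous fun g => (U g : H →L[ℂ] H) x

/-- The automorphism `T ↦ U(g) T U(g)*` of `B(H)`. -/
def conjBy (U : G →* unitary (H →L[ℂ] H)) (g : G) (T : H →L[ℂ] H) : H →L[ℂ] H :=
  (U g : H →L[ℂ] H) * T * star (U g : H →L[ℂ] H)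

/-- `U` induces an action of the topological group `G` on the C⋆-algebra `B`: each `Ad U(g)` maps
`B` into itself (hence onto itself), and the orbit maps `g ↦ U(g) b U(g)*`, `b ∈ B`, are
continuous in norm. -/
structure InducesAction (U : G →* unitary (H →L[ℂ] H))
    (B : NonUnitalStarSubalgebra ℂ (H →L[ℂ] H)) : Prop where
  mem : ∀ g, ∀ b ∈ B, conjBy U g b ∈ B
  continuous : ∀ b ∈ B, Continuous fun g => conjBy U g b

/-- The fixed-point algebra `B^G`. -/
def fixedPointAlgebra (U : G →* unitary (H →L[ℂ] H))
    (B : NonUnitalStarSubalgebra ℂ (H →L[ℂ] H)) : NonUnitalStarSubalgebra ℂ (H →L[ℂ] H) where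
  carrier := {b | b ∈ B ∧ ∀ g, conjBy U g b = b}
  add_mem' := by
    rintro a b ⟨ha, ha'⟩ ⟨hb, hb'⟩
    refine ⟨add_mem ha hb, fun g => ?_⟩
    have h1 := ha' g
    have h2 := hb' g
    simp only [conjBy] at h1 h2 ⊢
    rw [mul_add, add_mul, h1, h2]
  zero_mem' := ⟨zero_mem B, fun g => by simp [conjBy]⟩
  mul_mem' := by
    rintro a b ⟨ha, ha'⟩ ⟨hb, hb'⟩
    refine ⟨mul_mem ha hb, fun g => ?_⟩
    have h1 := ha' g
    have h2 := hb' g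
    have hu : star (U g : H →L[ℂ] H) * (U g : H →L[ℂ] H) = 1 := Unitary.coe_star_mul_self (U g)
    simp only [conjBy] at h1 h2 ⊢
    calc (U g : H →L[ℂ] H) * (a * b) * star (U g : H →L[ℂ] H)
        = (U g : H →L[ℂ] H) * a * (star (U g : H →L[ℂ] H) * (U g : H →L[ℂ] H)) * b *
            star (U g : H →L[ℂ] H) := by rw [hu, mul_one, mul_assoc (U g : H →L[ℂ] H) a b]
      _ = ((U g : H →L[ℂ] H) * a * star (U g : H →L[ℂ] H)) *
            ((U g : H →L[ℂ] H) * b * star (U g : H →L[ℂ] H)) := by simp only [mul_assoc]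
      _ = a * b := by rw [h1, h2]
  smul_mem' := by
    rintro c a ⟨ha, ha'⟩
    refine ⟨SMulMemClass.smul_mem c ha, fun g => ?_⟩
    have h1 := ha' g
    simp only [conjBy] at h1 ⊢
    rw [mul_smul_comm, smul_mul_assoc, h1]
  star_mem' := by
    rintro a ⟨ha, ha'⟩
    refine ⟨star_mem ha, fun g => ?_⟩
    have h1 := congrArg star (ha' g)
    simp only [conjBy, star_mul, star_star] at h1 ⊢
    rw [mul_assoc, h1]

/-- The action induced by `U` on `B` has full Hilbert spectrum: every irreducible continuous unitary
representation `σ` of `G` is realized on some Hilbert space `E` in `B`, i.e. there is a unitary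
equivalence `T` from `σ` onto the restriction of the action to `E`. As `G` is compact, it is enough
to take `σ` on the finite-dimensional Hilbert spaces `ℂⁿ`. -/
def HasFullHilbertSpectrum (U : G →* unitary (H →L[ℂ] H))
    (B : NonUnitalStarSubalgebra ℂ (H →L[ℂ] H)) : Prop :=
  ∀ (n : ℕ) (σ : G →* unitary (EuclideanSpace ℂ (Fin n) →L[ℂ] EuclideanSpace ℂ (Fin n))),
    IsContinuousUnitaryRep σ →
    ActsIrreducibly (Set.range fun g =>
      (σ g : EuclideanSpace ℂ (Fin n) →L[ℂ] EuclideanSpace ℂ (Fin n))) →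
    ∃ E : Submodule ℂ (H →L[ℂ] H), IsHilbertSpaceIn B E ∧
      ∃ T : EuclideanSpace ℂ (Fin n) ≃ₗ[ℂ] E,
        (∀ v w, star (T v : H →L[ℂ] H) * (T w : H →L[ℂ] H) =
          (inner ℂ v w : ℂ) • (1 : H →L[ℂ] H)) ∧
        ∀ g v, conjBy U g (T v : H →L[ℂ] H) =
          T ((σ g : EuclideanSpace ℂ (Fin n) →L[ℂ] EuclideanSpace ℂ (Fin n)) v)

end CompactGroupActions

end

/-!
A functional `b ↦ ⟪y, π b y⟫` that is ultraweakly continuous on the fixed-point algebra places `y`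
in the range of an operator that intertwines, on that algebra, a multiple of the identical
representation with `π`. So it suffices that for every such intertwiner `S` the range of `S` lies
in the closed span `L` of the ranges of the operators intertwining the two representations on the
whole algebra, since vectors of `L` give ultraweakly continuous functionals.

Let `Q` be the projection onto the complement of `L`; it commutes with `π`. If `x` is invariant
under the group, then averaging over the group and the orthogonality of a nontrivial irreducible
multiplet to the fixed vectors give `⟪S x, π b (S x)⟫ = c ⟪x, b x⟫` for all `b` in the algebra, so
that `b x ↦ π b (S x)` extends to an intertwiner and `Q S x = 0`. If `ψ₁, …, ψₙ` is an orthonormal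
basis of an invariant Hilbert space in the algebra, then `∑ ψₖ ψₖ*` is a fixed element acting as
the identity on each `ψᵢ x`, whence `S ψᵢ x = ∑ π(ψₖ) (π(ψₖ*) S ψᵢ) x`. The operators in brackets
are again intertwiners on the fixed-point algebra, so `Q S ψᵢ x = 0`. Full Hilbert spectrum and
the Peter–Weyl theorem make the products of fixed elements with such multiplets total, so `Q S`
vanishes on all `b x` and hence, by irreducibility, everywhere.
-/

noncomputable section

open scoped InnerProductSpace Topology
open MeasureTheory

universe u

section Schur

variable {H : Type*} [NormedAddCommGroup H] [InnerProductSpace ℂ H] {S : Set (H →L[ℂ] H)}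

theorem ActsIrreducibly.eq_zero_or_eq_zero_of_comp_eq_zero (hS : ActsIrreducibly S)
    {E F : Type*} [NormedAddCommGroup E] [NormedSpace ℂ E] [NormedAddCommGroup F] [NormedSpace ℂ F]
    {P : H →L[ℂ] E} {Q : F →L[ℂ] H} (hP : ∀ T ∈ S, ∀ x, P x = 0 → P (T x) = 0)
    (hPQ : P ∘L Q = 0) : P = 0 ∨ Q = 0 := by
  rcases hS.2 (LinearMap.ker P.toLinearMap) P.isClosed_ker hP with hker | hker
  · refine .inr (ContinuousLinearMap.ext fun x => ?_)
    have hx : Q x ∈ LinearMap.ker P.toLinearMap := DFunLike.congr_fun hPQ x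
    simpa [hker] using hx
  · exact .inl (ContinuousLinearMap.ext fun x => (hker ▸ Submodule.mem_top :
      x ∈ LinearMap.ker P.toLinearMap))

variable [CompleteSpace H]

theorem ActsIrreducibly.subsingleton_spectrum_of_commute (hS : ActsIrreducibly S)
    {A : H →L[ℂ] H} (hA : IsSelfAdjoint A) (hcomm : ∀ T ∈ S, Commute T A) :
    (spectrum ℝ A).Subsingleton := by
  by_contra hsub
  obtain ⟨s, hs, t, ht, hst⟩ := (Set.not_subsingleton_iff.1 hsub).exists_lt
  let m := (s + t) / 2
  let f : ℝ → ℝ := fun r => max (r - m) 0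
  let g : ℝ → ℝ := fun r => max (m - r) 0
  have hfg : cfc f A * cfc g A = 0 := by
    rw [← cfc_mul f g A, ← cfc_zero ℝ A]
    refine cfc_congr fun r _ => ?_
    rcases le_total r m with h | h <;> simp [f, g, h]
  have hker : ∀ T ∈ S, ∀ x, cfc f A x = 0 → cfc f A (T x) = 0 := fun T hT x hx => by
    have := DFunLike.congr_fun ((hcomm T hT).symm.cfc_real f).eq x
    simpa [hx] using this
  have hne : ∀ (h : ℝ → ℝ) (r : ℝ), Continuous h → r ∈ spectrum ℝ A → cfc h A = 0 → h r = 0 :=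
    fun h r hcont hr h0 => by
      have := hS.1
      have hmem := cfc_map_spectrum h A ▸ Set.mem_image_of_mem h hr
      simpa [h0] using hmem
  rcases hS.eq_zero_or_eq_zero_of_comp_eq_zero hker hfg with h0 | h0
  · have := hne f t (by fun_prop) ht h0
    simp only [f, m, max_eq_right_iff] at this
    linarith
  · have := hne g s (by fun_prop) hs h0
    simp only [g, m, max_eq_right_iff] at this
    linarith

theorem ActsIrreducibly.exists_eq_smul_one_of_isSelfAdjoint (hS : ActsIrreducibly S)
    {A : H →L[ℂ] H} (hA : IsSelfAdjoint A) (hcomm : ∀ T ∈ S, Commute T A) :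
    ∃ r : ℝ, A = (r : ℂ) • (1 : H →L[ℂ] H) := by
  have := hS.1
  obtain ⟨r, hr⟩ := ContinuousFunctionalCalculus.spectrum_nonempty (R := ℝ) A hA
  refine ⟨r, ?_⟩
  rw [CFC.eq_algebraMap_of_spectrum_subset_singleton A r
    fun s hs => hS.subsingleton_spectrum_of_commute hA hcomm hs hr, Algebra.algebraMap_eq_smul_one,
    Complex.coe_smul]

theorem ActsIrreducibly.exists_eq_smul_one (hS : ActsIrreducibly S) (hstar : ∀ T ∈ S, star T ∈ S)
    {A : H →L[ℂ] H} (hcomm : ∀ T ∈ S, Commute T A) : ∃ c : ℂ, A = c • (1 : H →L[ℂ] H) := by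
  have hcomm' : ∀ T ∈ S, Commute T (star A) := fun T hT => by
    simpa using (hcomm _ (hstar T hT)).star_star
  obtain ⟨r, hr⟩ := hS.exists_eq_smul_one_of_isSelfAdjoint (realPart A).2 fun T hT => by
    rw [realPart_apply_coe]
    exact ((hcomm T hT).add_right (hcomm' T hT)).smul_right _
  obtain ⟨s, hs⟩ := hS.exists_eq_smul_one_of_isSelfAdjoint (imaginaryPart A).2 fun T hT => by
    rw [imaginaryPart_apply_coe]
    exact (((hcomm T hT).sub_right (hcomm' T hT)).smul_right _).smul_right _
  refine ⟨r + Complex.I * s, ?_⟩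
  rw [← realPart_add_I_smul_imaginaryPart A, hr, hs, add_smul, mul_smul]

end Schur

section InvariantSubspaces

variable {A : Type*} [NonUnitalNonAssocSemiring A] [DistribMulAction ℂ A] [Star A]
  {H : Type*} [NormedAddCommGroup H] [InnerProductSpace ℂ H] [CompleteSpace H]

theorem starProjection_map_apply {θ : A →⋆ₙₐ[ℂ] (H →L[ℂ] H)} {N : Submodule ℂ H}
    [N.HasOrthogonalProjection] (hN : ∀ a, ∀ x ∈ N, θ a x ∈ N) (a : A) (x : H) :
    N.starProjection (θ a x) = θ a (N.starProjection x) := by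
  refine Submodule.eq_starProjection_of_mem_of_inner_eq_zero
    (hN a _ (Submodule.starProjection_apply_mem N x)) fun w hw => ?_
  rw [← map_sub, ← ContinuousLinearMap.adjoint_inner_right, ← ContinuousLinearMap.star_eq_adjoint,
    ← map_star]
  exact Submodule.inner_left_of_mem_orthogonal (hN _ _ hw)
    (Submodule.sub_starProjection_mem_orthogonal x)

end InvariantSubspaces

section Extension

variable {A : Type*} [AddCommGroup A] [Module ℂ A]
  {D : Type*} [NormedAddCommGroup D] [InnerProductSpace ℂ D] [CompleteSpace D]
  {K : Type*} [NormedAddCommGroup K] [NormedSpace ℂ K] [CompleteSpace K]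

theorem exists_clm_of_norm_le {e : A →ₗ[ℂ] D} {f : A →ₗ[ℂ] K} {C : ℝ}
    (h : ∀ a, ‖f a‖ ≤ C * ‖e a‖) :
    ∃ V : D →L[ℂ] K, (∀ a, V (e a) = f a) ∧
      ∀ ξ, V ((LinearMap.range e).topologicalClosure.starProjection ξ) = V ξ := by
  let N := (LinearMap.range e).topologicalClosure
  have hmem : ∀ a, e a ∈ N := fun a => Submodule.le_topologicalClosure _ ⟨a, rfl⟩
  let e' : A →ₗ[ℂ] N := e.codRestrict N hmem
  have hdense : DenseRange e' := fun x => by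
    have hrange : Subtype.val '' Set.range e' = (LinearMap.range e : Set D) := by
      rw [← Set.range_comp]; rfl
    rw [closure_subtype, hrange]
    exact x.2
  refine ⟨f.extendOfNorm e' ∘L N.orthogonalProjectionOnto, fun a => ?_, fun ξ => ?_⟩
  · have ha : N.orthogonalProjectionOnto (e a) = e' a :=
      Subtype.ext (Submodule.starProjection_eq_self_iff.2 (hmem a))
    rw [ContinuousLinearMap.comp_apply, ha]
    exact LinearMap.extendOfNorm_eq hdense ⟨C, h⟩ a
  · have hξ : N.orthogonalProjectionOnto (N.starProjection ξ) = N.orthogonalProjectionOnto ξ :=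
      Subtype.ext (Submodule.starProjection_eq_self_iff.2 (Submodule.starProjection_apply_mem N ξ))
    simp only [ContinuousLinearMap.comp_apply, N, hξ]

end Extension

section CyclicSubspaces

variable {A : Type*} [NonUnitalRing A] [StarRing A] [Module ℂ A]
  {D : Type*} [NormedAddCommGroup D] [InnerProductSpace ℂ D] [CompleteSpace D]
  {K : Type*} [NormedAddCommGroup K] [InnerProductSpace ℂ K] [CompleteSpace K]

/-- The orbit map `a ↦ θ a ζ` of a vector `ζ` in a representation `θ`. -/
def orbitMap (θ : A →⋆ₙₐ[ℂ] (D →L[ℂ] D)) (ζ : D) : A →ₗ[ℂ] D where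
  toFun a := θ a ζ
  map_add' a b := by rw [map_add, add_apply]
  map_smul' c a := by rw [map_smul, smul_apply, RingHom.id_apply]

/-- The cyclic subspace generated by `ζ`: the closure of the orbit `{θ a ζ}`. As no unit is assumed,
it may fail to contain `ζ`. -/
def cyclicSubspace (θ : A →⋆ₙₐ[ℂ] (D →L[ℂ] D)) (ζ : D) : Submodule ℂ D :=
  (LinearMap.range (orbitMap θ ζ)).topologicalClosure

theorem isClosed_cyclicSubspace (θ : A →⋆ₙₐ[ℂ] (D →L[ℂ] D)) (ζ : D) :
    IsClosed (cyclicSubspace θ ζ : Set D) :=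
  Submodule.isClosed_topologicalClosure _

instance (θ : A →⋆ₙₐ[ℂ] (D →L[ℂ] D)) (ζ : D) : CompleteSpace (cyclicSubspace θ ζ) :=
  (isClosed_cyclicSubspace θ ζ).completeSpace_coe

theorem map_mem_cyclicSubspace (θ : A →⋆ₙₐ[ℂ] (D →L[ℂ] D)) (ζ : D) (a : A) :
    θ a ζ ∈ cyclicSubspace θ ζ :=
  Submodule.le_topologicalClosure _ ⟨a, rfl⟩

theorem cyclicSubspace_le {θ : A →⋆ₙₐ[ℂ] (D →L[ℂ] D)} {ζ : D} {N : Submodule ℂ D}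
    (hN : IsClosed (N : Set D)) (h : ∀ a, θ a ζ ∈ N) : cyclicSubspace θ ζ ≤ N :=
  Submodule.topologicalClosure_minimal _ (by rintro _ ⟨a, rfl⟩; exact h a) hN

theorem map_apply_mem_cyclicSubspace (θ : A →⋆ₙₐ[ℂ] (D →L[ℂ] D)) (ζ : D) (a : A) :
    ∀ ξ ∈ cyclicSubspace θ ζ, θ a ξ ∈ cyclicSubspace θ ζ := by
  intro ξ hξ
  refine map_mem_closure (θ a).continuous hξ ?_
  rintro _ ⟨b, rfl⟩
  exact ⟨a * b, by
    simp only [orbitMap, LinearMap.coe_mk, AddHom.coe_mk, map_mul, mul_apply_eq_comp]⟩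

theorem exists_intertwiner_of_norm_le {θ : A →⋆ₙₐ[ℂ] (D →L[ℂ] D)} {π : A →⋆ₙₐ[ℂ] (K →L[ℂ] K)}
    {ζ : D} {y : K} {C : ℝ} (h : ∀ a, ‖π a y‖ ≤ C * ‖θ a ζ‖)
    (hunit : ∃ e, θ e ζ = ζ ∧ π e y = y) :
    ∃ V : D →L[ℂ] K, (∀ a ξ, V (θ a ξ) = π a (V ξ)) ∧ V ζ = y := by
  obtain ⟨V, hV, hVP⟩ := exists_clm_of_norm_le (e := orbitMap θ ζ) (f := orbitMap π y) h
  change ∀ a, V (θ a ζ) = π a y at hV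
  change ∀ ξ, V ((cyclicSubspace θ ζ).starProjection ξ) = V ξ at hVP
  refine ⟨V, fun a ξ => ?_, ?_⟩
  · have hcyclic : cyclicSubspace θ ζ ≤ LinearMap.ker (V ∘L θ a - π a ∘L V).toLinearMap :=
      cyclicSubspace_le (ContinuousLinearMap.isClosed_ker _) fun b => by
        change V (θ a (θ b ζ)) - π a (V (θ b ζ)) = 0
        rw [hV, ← mul_apply_eq_comp, ← mul_apply_eq_comp, ← map_mul, ← map_mul, hV, sub_self]
    rw [← hVP, starProjection_map_apply (map_apply_mem_cyclicSubspace θ ζ), ← hVP ξ]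
    exact sub_eq_zero.1 (hcyclic (Submodule.starProjection_apply_mem _ ξ))
  · obtain ⟨e, heζ, hey⟩ := hunit
    rw [← heζ, hV, hey]

end CyclicSubspaces

section Amplification

variable {H : Type*} [NormedAddCommGroup H] [InnerProductSpace ℂ H]

/-- The diagonal operator `⨁ T` on the Hilbert sum of copies of `H` indexed by `ι`. -/
def ampCLM (ι : Type*) (T : H →L[ℂ] H) :
    lp (fun _ : ι => H) 2 →L[ℂ] lp (fun _ : ι => H) 2 :=
  have hmem : ∀ x : lp (fun _ : ι => H) 2, Memℓp (fun i => T (x i)) 2 := fun x =>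
    ((lp.memℓp x).norm.const_mul ‖T‖).mono' fun i =>
      (T.le_opNorm _).trans (le_abs_self _)
  LinearMap.mkContinuous
    { toFun := fun x => ⟨fun i => T (x i), hmem x⟩
      map_add' := fun x y => by ext i; exact map_add T (x i) (y i)
      map_smul' := fun c x => by ext i; exact map_smul T c (x i) } ‖T‖ fun x => by
    have h2 : (0 : ℝ) < (2 : ENNReal).toReal := by norm_num
    refine lp.norm_le_of_forall_sum_le h2 (by positivity) fun s => ?_
    calc ∑ i ∈ s, ‖T (x i)‖ ^ (2 : ENNReal).toReal
        ≤ ∑ i ∈ s, ‖T‖ ^ (2 : ENNReal).toReal * ‖x i‖ ^ (2 : ENNReal).toReal := by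
          gcongr with i
          rw [← Real.mul_rpow (norm_nonneg _) (norm_nonneg _)]
          exact Real.rpow_le_rpow (norm_nonneg _) (T.le_opNorm _) h2.le
      _ ≤ (‖T‖ * ‖x‖) ^ (2 : ENNReal).toReal := by
          rw [← Finset.mul_sum, Real.mul_rpow (norm_nonneg _) (norm_nonneg _)]
          gcongr
          exact lp.sum_rpow_le_norm_rpow h2 x s

@[simp]
theorem ampCLM_apply (ι : Type*) (T : H →L[ℂ] H) (x : lp (fun _ : ι => H) 2) (i : ι) :
    ampCLM ι T x i = T (x i) := rfl

variable [CompleteSpace H]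

variable (H) in
/-- The amplification `T ↦ ⨁ T` as a homomorphism of star-algebras. -/
def amp (ι : Type*) :
    (H →L[ℂ] H) →⋆ₙₐ[ℂ] (lp (fun _ : ι => H) 2 →L[ℂ] lp (fun _ : ι => H) 2) where
  toFun := ampCLM ι
  map_smul' c T := by ext x i; simp
  map_zero' := by ext x i; simp
  map_add' S T := by ext x i; simp
  map_mul' S T := by ext x i; simp
  map_star' T := by
    refine (ContinuousLinearMap.eq_adjoint_iff _ _).2 fun x y => ?_
    simp only [lp.inner_eq_tsum, ampCLM_apply, ContinuousLinearMap.star_eq_adjoint,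
      ContinuousLinearMap.adjoint_inner_left]

@[simp]
theorem amp_apply (ι : Type*) (T : H →L[ℂ] H) (x : lp (fun _ : ι => H) 2) (i : ι) :
    amp H ι T x i = T (x i) := rfl

theorem amp_single {ι : Type*} [DecidableEq ι] (T : H →L[ℂ] H) (i : ι) (x : H) :
    amp H ι T (lp.single 2 i x) = lp.single 2 i (T x) := by
  ext j
  obtain rfl | hj := eq_or_ne j i
  · simp
  · simp [hj]

end Amplification

section Density

variable {H : Type*} [NormedAddCommGroup H] [InnerProductSpace ℂ H] [CompleteSpace H]
  {B : NonUnitalStarSubalgebra ℂ (H →L[ℂ] H)}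

theorem ActsIrreducibly.comp_amp_eq_amp_comp (hirr : ActsIrreducibly (B : Set (H →L[ℂ] H)))
    {ι : Type*} {P : lp (fun _ : ι => H) 2 →L[ℂ] lp (fun _ : ι => H) 2}
    (hP : ∀ b ∈ B, ∀ ξ, P (amp H ι b ξ) = amp H ι b (P ξ)) (T : H →L[ℂ] H) :
    P ∘L amp H ι T = amp H ι T ∘L P := by
  classical
  -- By Schur's lemma the entries of `P` are scalars.
  have hentry : ∀ i j, ∃ c : ℂ, ∀ x, P (lp.single 2 j x) i = c • x := by
    intro i j
    obtain ⟨c, hc⟩ := hirr.exists_eq_smul_one (fun _ => star_mem)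
      (A := lp.evalCLM ℂ (fun _ : ι => H) 2 i ∘L P ∘L
        lp.singleContinuousLinearMap ℂ (fun _ : ι => H) 2 j) fun b hb => by
        ext x
        change b (P (lp.single 2 j x) i) = P (lp.single 2 j (b x)) i
        rw [← amp_single, hP b hb, amp_apply]
    exact ⟨c, fun x => DFunLike.congr_fun hc x⟩
  refine lp.ext_continuousLinearMap (by norm_num) fun j => ContinuousLinearMap.ext fun x => ?_
  ext i
  obtain ⟨c, hc⟩ := hentry i j
  change P (amp H ι T (lp.single 2 j x)) i = T (P (lp.single 2 j x) i)
  rw [amp_single, hc, hc, map_smul]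

theorem ActsIrreducibly.inner_amp_eq_zero (hirr : ActsIrreducibly (B : Set (H →L[ℂ] H)))
    (h1 : 1 ∈ B) {ι : Type*} {υ ζ : lp (fun _ : ι => H) 2}
    (h : ∀ b ∈ B, ⟪υ, amp H ι b ζ⟫_ℂ = 0) (T : H →L[ℂ] H) : ⟪υ, amp H ι T ζ⟫_ℂ = 0 := by
  let θ : B →⋆ₙₐ[ℂ] _ := (amp H ι).comp (NonUnitalStarSubalgebraClass.subtype B)
  let N := cyclicSubspace θ ζ
  have hN : N ≤ (ℂ ∙ υ)ᗮ := cyclicSubspace_le (Submodule.isClosed_orthogonal _) fun b =>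
    Submodule.mem_orthogonal_singleton_iff_inner_right.2 (h b b.2)
  have hζ : N.starProjection ζ = ζ :=
    Submodule.starProjection_eq_self_iff.2 (map_mem_cyclicSubspace θ ζ ⟨1, h1⟩)
  have hTζ : N.starProjection (amp H ι T ζ) = amp H ι T ζ := by
    have := DFunLike.congr_fun (hirr.comp_amp_eq_amp_comp (P := N.starProjection)
      (fun b hb => starProjection_map_apply (map_apply_mem_cyclicSubspace θ ζ) ⟨b, hb⟩) T) ζ
    rwa [ContinuousLinearMap.comp_apply, ContinuousLinearMap.comp_apply, hζ] at this
  exact Submodule.mem_orthogonal_singleton_iff_inner_right.1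
    (hN (Submodule.starProjection_eq_self_iff.1 hTζ))

theorem ActsIrreducibly.sum_inner_eq_zero (hirr : ActsIrreducibly (B : Set (H →L[ℂ] H)))
    (h1 : 1 ∈ B) {ι : Type*} [Fintype ι] {u z : ι → H}
    (h : ∀ b ∈ B, ∑ i, ⟪u i, b (z i)⟫_ℂ = 0) (T : H →L[ℂ] H) : ∑ i, ⟪u i, T (z i)⟫_ℂ = 0 := by
  let υ : lp (fun _ : ι => H) 2 := ⟨u, Memℓp.all u⟩
  let ζ : lp (fun _ : ι => H) 2 := ⟨z, Memℓp.all z⟩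
  have hsum : ∀ S : H →L[ℂ] H, ⟪υ, amp H ι S ζ⟫_ℂ = ∑ i, ⟪u i, S (z i)⟫_ℂ := fun S => by
    rw [lp.inner_eq_tsum, tsum_fintype]; rfl
  rw [← hsum]
  exact hirr.inner_amp_eq_zero h1 (fun b hb => (hsum b).trans (h b hb)) T

theorem ActsIrreducibly.eq_zero_of_apply_eq_zero (hirr : ActsIrreducibly (B : Set (H →L[ℂ] H)))
    (h1 : 1 ∈ B) {E : Type*} [NormedAddCommGroup E] [NormedSpace ℂ E] {R : H →L[ℂ] E} {x : H}
    (hx : x ≠ 0) (hR : ∀ b ∈ B, R (b x) = 0) : R = 0 := by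
  let M : Submodule ℂ H := ⨅ b : B, LinearMap.ker (R ∘L (b : H →L[ℂ] H)).toLinearMap
  have hmem : ∀ y, y ∈ M ↔ ∀ b ∈ B, R (b y) = 0 := fun y => by
    simp only [M, Submodule.mem_iInf, Subtype.forall]
    rfl
  have hclosed : IsClosed (M : Set H) := by
    rw [Submodule.coe_iInf]
    exact isClosed_iInter fun b => ContinuousLinearMap.isClosed_ker _
  rcases hirr.2 M hclosed fun c hc y hy =>
    (hmem _).2 fun b hb => (hmem y).1 hy (b * c) (mul_mem hb hc) with hM | hM
  · exact absurd ((Submodule.mem_bot ℂ).1 (hM ▸ (hmem x).2 hR)) hx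
  · ext y
    exact (hmem y).1 (hM ▸ Submodule.mem_top) 1 h1

end Density

section UnitaryReps

/-- Unitary representations of `G` on `H`, without any continuity. -/
abbrev UnitaryRep (G H : Type*) [Group G] [NormedAddCommGroup H] [InnerProductSpace ℂ H]
    [CompleteSpace H] := G →* unitary (H →L[ℂ] H)

variable {G : Type*} [Group G]
  {H : Type*} [NormedAddCommGroup H] [InnerProductSpace ℂ H] [CompleteSpace H]

/-- The unitary representation given by a multiplicative family of bounded operators with
`s(g)* = s(g⁻¹)`. -/
def unitaryRepOfStar (s : G → (H →L[ℂ] H)) (h1 : s 1 = 1) (hmul : ∀ g h, s (g * h) = s g * s h)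
    (hstar : ∀ g, star (s g) = s g⁻¹) : UnitaryRep G H where
  toFun g := ⟨s g, by
    rw [Unitary.mem_iff, hstar, ← hmul, ← hmul, inv_mul_cancel, mul_inv_cancel, h1]
    exact ⟨rfl, rfl⟩⟩
  map_one' := Subtype.ext h1
  map_mul' g h := Subtype.ext (hmul g h)

theorem star_unitaryRep (U : UnitaryRep G H) (g : G) : star (U g).1 = (U g⁻¹).1 := by
  rw [map_inv, ← Unitary.star_eq_inv, Unitary.coe_star]

theorem inner_unitaryRep_left (U : UnitaryRep G H) (g : G) (x y : H) :
    ⟪(U g).1 x, y⟫_ℂ = ⟪x, (U g⁻¹).1 y⟫_ℂ := by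
  rw [← star_unitaryRep, ContinuousLinearMap.star_eq_adjoint,
    ContinuousLinearMap.adjoint_inner_right]

theorem inner_unitaryRep_right (U : UnitaryRep G H) (g : G) (x y : H) :
    ⟪x, (U g).1 y⟫_ℂ = ⟪(U g⁻¹).1 x, y⟫_ℂ := by
  rw [inner_unitaryRep_left, inv_inv]

theorem unitaryRep_mul_apply (U : UnitaryRep G H) (g h : G) (x : H) :
    (U (g * h)).1 x = (U g).1 ((U h).1 x) := by
  rw [map_mul]; rfl

theorem unitaryRep_one_apply (U : UnitaryRep G H) (x : H) : (U 1).1 x = x := by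
  rw [map_one]; rfl

theorem unitaryRep_inv_apply_self (U : UnitaryRep G H) (g : G) (x : H) :
    (U g⁻¹).1 ((U g).1 x) = x := by
  rw [← unitaryRep_mul_apply, inv_mul_cancel, unitaryRep_one_apply]

theorem exists_restriction {E : Type*} [NormedAddCommGroup E] [InnerProductSpace ℂ E]
    [CompleteSpace E] (U : UnitaryRep G H) (J : E →ₗᵢ[ℂ] H)
    (hinv : ∀ g v, ∃ w, J w = (U g).1 (J v)) :
    ∃ σ : UnitaryRep G E, ∀ g v, (U g).1 (J v) = J ((σ g).1 v) := by
  let J' := J.toContinuousLinearMap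
  let s : G → E →L[ℂ] E := fun g => J'.adjoint ∘L (U g).1 ∘L J'
  have hs : ∀ g v, (U g).1 (J v) = J (s g v) := fun g v => by
    obtain ⟨w, hw⟩ := hinv g v
    have hsv : s g v = w := ext_inner_left ℂ fun u => by
      change ⟪u, J'.adjoint ((U g).1 (J v))⟫_ℂ = ⟪u, w⟫_ℂ
      rw [← hw, ContinuousLinearMap.adjoint_inner_right]
      exact J.inner_map_map u w
    rw [← hw, hsv]
  refine ⟨unitaryRepOfStar s (ContinuousLinearMap.ext fun v => J.injective ?_)
    (fun g h => ContinuousLinearMap.ext fun v => J.injective ?_) (fun g => ?_), hs⟩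
  · rw [← hs, unitaryRep_one_apply]; rfl
  · rw [← hs, unitaryRep_mul_apply, hs, hs]; rfl
  · simp only [s, ContinuousLinearMap.star_eq_adjoint, ContinuousLinearMap.adjoint_comp,
      ContinuousLinearMap.adjoint_adjoint, ← star_unitaryRep U g]
    rfl

theorem exists_minimal_invariant_submodule (U : UnitaryRep G H) {E : Submodule ℂ H}
    [FiniteDimensional ℂ E] (hE : E ≠ ⊥) (hinv : ∀ g, ∀ x ∈ E, (U g).1 x ∈ E) :
    ∃ V ≤ E, Minimal (fun V : Submodule ℂ H => V ≠ ⊥ ∧ ∀ g, ∀ x ∈ V, (U g).1 x ∈ V) V := by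
  obtain ⟨V, ⟨hVE, hV⟩, hmin⟩ := WellFounded.has_min
    (measure fun V : Submodule ℂ H => Module.finrank ℂ V).wf
    {V | V ≤ E ∧ V ≠ ⊥ ∧ ∀ g, ∀ x ∈ V, (U g).1 x ∈ V} ⟨E, le_rfl, hE, hinv⟩
  have : FiniteDimensional ℂ V := Submodule.finiteDimensional_of_le hVE
  exact ⟨V, hVE, hV, fun W hW hWV => (Submodule.eq_of_le_of_finrank_le hWV
    (not_lt.1 (hmin W ⟨hWV.trans hVE, hW⟩))).ge⟩

variable [TopologicalSpace G]

/-- `σ` is an irreducible continuous unitary representation on `ℂⁿ`. -/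
structure IsIrreducibleRep {n : ℕ} (σ : UnitaryRep G (EuclideanSpace ℂ (Fin n))) : Prop where
  continuous : IsContinuousUnitaryRep σ
  irreducible : ActsIrreducibly (Set.range fun g => (σ g).1)

theorem IsContinuousUnitaryRep.exists_irreducible_restriction {U : UnitaryRep G H}
    (hU : IsContinuousUnitaryRep U) {E : Submodule ℂ H} [FiniteDimensional ℂ E] (hE : E ≠ ⊥)
    (hinv : ∀ g, ∀ x ∈ E, (U g).1 x ∈ E) :
    ∃ (n : ℕ) (σ : UnitaryRep G (EuclideanSpace ℂ (Fin n))) (J : EuclideanSpace ℂ (Fin n) →ₗᵢ[ℂ] H),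
      IsIrreducibleRep σ ∧ (∀ v, J v ∈ E) ∧ ∀ g v, (U g).1 (J v) = J ((σ g).1 v) := by
  obtain ⟨V, hVE, ⟨hV0, hVinv⟩, hVmin⟩ := exists_minimal_invariant_submodule U hE hinv
  have : FiniteDimensional ℂ V := Submodule.finiteDimensional_of_le hVE
  let e := (stdOrthonormalBasis ℂ V).repr
  let J : EuclideanSpace ℂ (Fin (Module.finrank ℂ V)) →ₗᵢ[ℂ] H :=
    V.subtypeₗᵢ.comp e.symm.toLinearIsometry
  have hJV : ∀ v, J v ∈ V := fun v => (e.symm v).2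
  obtain ⟨σ, hσ⟩ := exists_restriction U J fun g v =>
    ⟨e ⟨_, hVinv g _ (hJV v)⟩, congrArg Subtype.val (e.symm_apply_apply _)⟩
  refine ⟨_, σ, J, ⟨fun v => ?_, ?_, fun M _ hM => ?_⟩, fun v => hVE (hJV v), hσ⟩
  · exact J.isometry.isEmbedding.continuous_iff.2 ((hU (J v)).congr fun g => hσ g v)
  · have : Nontrivial V := Submodule.nontrivial_iff_ne_bot.2 hV0
    exact e.toEquiv.symm.nontrivial
  · refine or_iff_not_imp_left.2 fun hM0 => ?_
    have hle : V ≤ M.map J.toLinearMap := hVmin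
      ⟨fun h => hM0 (Submodule.map_injective_of_injective J.injective
        (h.trans (Submodule.map_bot _).symm)), fun g x hx => ?_⟩ ?_
    · refine eq_top_iff.2 fun v _ => ?_
      obtain ⟨w, hw, hwv⟩ := hle (hJV v)
      exact J.injective hwv ▸ hw
    · obtain ⟨v, hv, rfl⟩ := hx
      exact ⟨(σ g).1 v, hM _ ⟨g, rfl⟩ v hv, (hσ g v).symm⟩
    · rintro _ ⟨v, _, rfl⟩
      exact hJV v

end UnitaryReps

section CompactGroups

variable {G : Type*} [TopologicalSpace G] [CompactSpace G] [MeasurableSpace G] [BorelSpace G]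

theorem integrable_of_continuous {μ : Measure G} [IsFiniteMeasureOnCompacts μ]
    {X : Type*} [NormedAddCommGroup X] {f : G → X} (hf : Continuous f) : Integrable f μ :=
  hf.integrable_of_hasCompactSupport (HasCompactSupport.of_compactSpace f)

variable [Group G]

variable (G) in
theorem exists_isHaarMeasure_isProbabilityMeasure [IsTopologicalGroup G] :
    ∃ μ : Measure G, μ.IsHaarMeasure ∧ IsProbabilityMeasure μ :=
  ⟨Measure.haarMeasure ⊤, inferInstance, ⟨Measure.haarMeasure_self⟩⟩

variable {H : Type*} [NormedAddCommGroup H] [InnerProductSpace ℂ H] [CompleteSpace H]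

/-- The operator `∫ |U(g) z⟩⟨U(g) z| dg`, the average over `G` of the rank one operator `|z⟩⟨z|`. -/
def averagedRankOne (μ : Measure G) (U : UnitaryRep G H) (z : H) : H →L[ℂ] H :=
  ∫ g, InnerProductSpace.rankOne ℂ ((U g).1 z) ((U g).1 z) ∂μ

variable {μ : Measure G} [IsFiniteMeasureOnCompacts μ] {U : UnitaryRep G H}

theorem IsContinuousUnitaryRep.integrable_rankOne (hU : IsContinuousUnitaryRep U) (z : H) :
    Integrable (fun g => InnerProductSpace.rankOne ℂ ((U g).1 z) ((U g).1 z)) μ :=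
  integrable_of_continuous (((ContinuousLinearMap.smulRightL ℂ H H).continuous.comp
    ((innerSL ℂ).continuous.comp (hU z))).clm_apply (hU z))

theorem inner_averagedRankOne_apply (hU : IsContinuousUnitaryRep U) (x y z : H) :
    ⟪x, averagedRankOne μ U z y⟫_ℂ = ∫ g, ⟪(U g).1 z, y⟫_ℂ * ⟪x, (U g).1 z⟫_ℂ ∂μ := by
  have hInt := hU.integrable_rankOne (μ := μ) z
  rw [averagedRankOne, ContinuousLinearMap.integral_apply hInt, ← integral_inner
    (hInt.apply_continuousLinearMap y)]
  simp only [InnerProductSpace.rankOne_apply, inner_smul_right]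

theorem isCompactOperator_averagedRankOne [IsProbabilityMeasure μ] (hU : IsContinuousUnitaryRep U)
    (z : H) : IsCompactOperator (averagedRankOne μ U z) := by
  have hconv : Convex ℝ {S : H →L[ℂ] H | IsCompactOperator S} :=
    ((compactOperator (RingHom.id ℂ) H H).restrictScalars ℝ).convex
  refine hconv.integral_mem isClosed_setOfPred_isCompactOperator
    (Filter.Eventually.of_forall fun g => ?_) (hU.integrable_rankOne z)
  exact (isCompactOperator_id.clm_comp (ContinuousLinearMap.toSpanSingleton ℂ
    ((U g).1 z))).comp_clm (innerSL ℂ ((U g).1 z))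

theorem isSymmetric_averagedRankOne (hU : IsContinuousUnitaryRep U) (z : H) :
    (averagedRankOne μ U z : H →ₗ[ℂ] H).IsSymmetric := fun x y => by
  rw [← inner_conj_symm, ContinuousLinearMap.coe_coe, inner_averagedRankOne_apply hU,
    inner_averagedRankOne_apply hU, ← integral_conj]
  simp only [map_mul, inner_conj_symm, mul_comm]

theorem averagedRankOne_unitaryRep_apply [IsTopologicalGroup G] [μ.IsMulLeftInvariant]
    (hU : IsContinuousUnitaryRep U) (z : H) (g : G) (x : H) :
    averagedRankOne μ U z ((U g).1 x) = (U g).1 (averagedRankOne μ U z x) := by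
  refine ext_inner_left ℂ fun y => ?_
  rw [inner_unitaryRep_right, inner_averagedRankOne_apply hU, inner_averagedRankOne_apply hU,
    ← integral_mul_left_eq_self _ g]
  simp only [unitaryRep_mul_apply, inner_unitaryRep_left U g, inner_unitaryRep_right U g y,
    unitaryRep_inv_apply_self]

theorem averagedRankOne_ne_zero [μ.IsOpenPosMeasure] (hU : IsContinuousUnitaryRep U) {z : H}
    (hz : z ≠ 0) : averagedRankOne μ U z ≠ 0 := fun h0 => by
  have hcont : Continuous fun g => ‖⟪z, (U g).1 z⟫_ℂ‖ ^ 2 :=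
    (continuous_const.inner (hU z)).norm.pow 2
  have hpos : 0 < ∫ g, ‖⟪z, (U g).1 z⟫_ℂ‖ ^ 2 ∂μ :=
    hcont.integral_pos_of_hasCompactSupport_nonneg_nonzero (x := 1)
      (HasCompactSupport.of_compactSpace _) (fun g => by positivity)
      (by rw [unitaryRep_one_apply]; simpa using hz)
  refine hpos.ne' (Complex.ofReal_injective ?_)
  calc ((∫ g, ‖⟪z, (U g).1 z⟫_ℂ‖ ^ 2 ∂μ : ℝ) : ℂ) = ⟪z, averagedRankOne μ U z z⟫_ℂ := by
        rw [inner_averagedRankOne_apply hU, ← integral_complex_ofReal]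
        refine integral_congr_ae (Filter.Eventually.of_forall fun g => ?_)
        simp only [← inner_conj_symm ((U g).1 z) z, Complex.conj_mul', Complex.ofReal_pow]
    _ = 0 := by rw [h0, zero_apply, inner_zero_right]

end CompactGroups

section Totality

variable {G : Type*} [Group G] [TopologicalSpace G] [IsTopologicalGroup G] [CompactSpace G]
  {H : Type*} [NormedAddCommGroup H] [InnerProductSpace ℂ H] [CompleteSpace H]
  {U : UnitaryRep G H}

theorem IsContinuousUnitaryRep.eq_zero_of_forall_inner_eq_zero (hU : IsContinuousUnitaryRep U)
    {z : H} (h : ∀ (n : ℕ) (σ : UnitaryRep G (EuclideanSpace ℂ (Fin n)))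
      (J : EuclideanSpace ℂ (Fin n) →ₗᵢ[ℂ] H), IsIrreducibleRep σ →
      (∀ g v, (U g).1 (J v) = J ((σ g).1 v)) → ∀ v, ⟪J v, z⟫_ℂ = 0) : z = 0 := by
  borelize G
  obtain ⟨μ, _, _⟩ := exists_isHaarMeasure_isProbabilityMeasure G
  by_contra hz
  let T := averagedRankOne μ U z
  have hcompact : IsCompactOperator T := isCompactOperator_averagedRankOne hU z
  obtain ⟨c, hc, hc0⟩ : ∃ c, Module.End.HasEigenvalue (T : Module.End ℂ H) c ∧ c ≠ 0 := by
    by_contra! hcon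
    exact averagedRankOne_ne_zero hU hz ((T.eq_zero_of_forall_hasEigenvalue_eq_zero hcompact
      (isSymmetric_averagedRankOne hU z)).1 hcon)
  have := ContinuousLinearMap.finite_dimensional_eigenspace hcompact c hc0
  obtain ⟨n, σ, J, hσ, hJE, hJ⟩ := hU.exists_irreducible_restriction
    (E := Module.End.eigenspace (T : Module.End ℂ H) c) hc fun g x hx => by
      rw [Module.End.mem_eigenspace_iff, ContinuousLinearMap.coe_coe] at hx ⊢
      rw [averagedRankOne_unitaryRep_apply hU, hx, map_smul]
  have := hσ.irreducible.1
  obtain ⟨v, hv⟩ := exists_ne (0 : EuclideanSpace ℂ (Fin n))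
  have horth : ∀ g, ⟪J v, (U g).1 z⟫_ℂ = 0 := fun g => by
    rw [inner_unitaryRep_right, hJ]
    exact h n σ J hσ hJ _
  have hzero : ⟪J v, T (J v)⟫_ℂ = 0 := by
    rw [inner_averagedRankOne_apply hU]
    simp only [horth, mul_zero, integral_zero]
  have heigen : T (J v) = c • J v := Module.End.mem_eigenspace_iff.1 (hJE v)
  rw [heigen, inner_smul_right, J.inner_map_map] at hzero
  exact hv (inner_self_eq_zero.1 ((mul_eq_zero.1 hzero).resolve_left hc0))

end Totality

section RegularRepresentation

variable {G : Type*} [Group G] [TopologicalSpace G] [IsTopologicalGroup G]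

/-- The orbit `g ↦ (x ↦ w(g⁻¹x))` of a continuous function under left translation. -/
def leftTranslate (w : C(G, ℂ)) : C(G, C(G, ℂ)) :=
  ContinuousMap.curry ⟨fun p => w (p.1⁻¹ * p.2), by fun_prop⟩

variable [MeasurableSpace G] [BorelSpace G] (μ : Measure G) [μ.IsHaarMeasure]

/-- Left translation by `g` on `L²(G)`. -/
def leftTranslation (g : G) : Lp ℂ 2 μ →ₗᵢ[ℂ] Lp ℂ 2 μ where
  toFun f := DomMulAct.mk g⁻¹ • f
  map_add' f k := smul_add _ f k
  map_smul' c f := smul_comm _ c f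
  norm_map' f := DomMulAct.norm_smul_Lp _ f

theorem leftTranslation_mul (g h : G) (f : Lp ℂ 2 μ) :
    leftTranslation μ (g * h) f = leftTranslation μ g (leftTranslation μ h f) := by
  change DomMulAct.mk (g * h)⁻¹ • f = DomMulAct.mk g⁻¹ • DomMulAct.mk h⁻¹ • f
  rw [smul_smul, ← DomMulAct.mk_mul, mul_inv_rev]

theorem leftTranslation_one (f : Lp ℂ 2 μ) : leftTranslation μ 1 f = f := by
  change DomMulAct.mk (1 : G)⁻¹ • f = f
  rw [inv_one, DomMulAct.mk_one, one_smul]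

/-- The left regular representation of `G` on `L²(G)`. -/
def regularRep : UnitaryRep G (Lp ℂ 2 μ) :=
  unitaryRepOfStar (fun g => (leftTranslation μ g).toContinuousLinearMap)
    (ContinuousLinearMap.ext (leftTranslation_one μ))
    (fun g h => ContinuousLinearMap.ext (leftTranslation_mul μ g h))
    (fun g => Eq.symm <| (ContinuousLinearMap.eq_adjoint_iff _ _).2 fun x y => by
      change ⟪leftTranslation μ g⁻¹ x, y⟫_ℂ = ⟪x, leftTranslation μ g y⟫_ℂ
      rw [← (leftTranslation μ g).inner_map_map (leftTranslation μ g⁻¹ x) y,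
        ← leftTranslation_mul, mul_inv_cancel, leftTranslation_one])

variable [CompactSpace G]

theorem isContinuousUnitaryRep_regularRep : IsContinuousUnitaryRep (regularRep μ) := fun f => by
  have : Fact ((2 : ENNReal) ≠ ⊤) := ⟨ENNReal.ofNat_ne_top⟩
  exact (DomMulAct.mkHomeomorph.continuous.comp continuous_inv).smul continuous_const

theorem toLp_leftTranslate (w : C(G, ℂ)) (g : G) :
    ContinuousMap.toLp (E := ℂ) 2 μ ℂ (leftTranslate w g) =
      (regularRep μ g).1 (ContinuousMap.toLp (E := ℂ) 2 μ ℂ w) :=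
  rfl

end RegularRepresentation

section PeterWeyl

variable {G : Type*} [Group G] [TopologicalSpace G] [IsTopologicalGroup G] [CompactSpace G]
  [MeasurableSpace G] [BorelSpace G] {μ : Measure G}

/-- `f` is orthogonal to the matrix coefficients of all irreducible representations of `G`. -/
def IsOrthogonalToCoeffs (μ : Measure G) (f : G → ℂ) : Prop :=
  ∀ (n : ℕ) (σ : UnitaryRep G (EuclideanSpace ℂ (Fin n))), IsIrreducibleRep σ →
    ∀ v w, ∫ g, f g * ⟪(σ g).1 w, v⟫_ℂ ∂μ = 0

theorem IsOrthogonalToCoeffs.integral_smul_unitaryRep_eq_zero [IsFiniteMeasureOnCompacts μ]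
    {H : Type*} [NormedAddCommGroup H] [InnerProductSpace ℂ H] [CompleteSpace H]
    {U : UnitaryRep G H} (hU : IsContinuousUnitaryRep U) {f : G → ℂ} (hf : Continuous f)
    (h : IsOrthogonalToCoeffs μ f) (w : H) :
    ∫ g, starRingEnd ℂ (f g) • (U g).1 w ∂μ = 0 := by
  refine hU.eq_zero_of_forall_inner_eq_zero fun n σ J hσ hJ v => ?_
  have hInt : Integrable (fun g => starRingEnd ℂ (f g) • (U g).1 w) μ :=
    integrable_of_continuous ((Complex.continuous_conj.comp hf).smul (hU w))
  rw [← integral_inner hInt, ← map_zero (starRingEnd ℂ),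
    ← h n σ hσ v (J.toContinuousLinearMap.adjoint w), ← integral_conj]
  refine integral_congr_ae (Filter.Eventually.of_forall fun g => ?_)
  simp only
  rw [inner_smul_right, map_mul, inner_conj_symm, inner_unitaryRep_right, hJ,
    inner_unitaryRep_right σ, ContinuousLinearMap.adjoint_inner_right]
  rfl

theorem IsOrthogonalToCoeffs.eq_zero [μ.IsHaarMeasure] {f : G → ℂ} (hf : Continuous f)
    (h : IsOrthogonalToCoeffs μ f) : f = 0 := by
  let w : C(G, ℂ) := ⟨fun g => f g⁻¹, by fun_prop⟩
  have hcont : Continuous fun g => starRingEnd ℂ (f g) • leftTranslate w g :=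
    (Complex.continuous_conj.comp hf).smul (leftTranslate w).continuous
  have hzero : ∫ g, starRingEnd ℂ (f g) • leftTranslate w g ∂μ = 0 := by
    refine ContinuousMap.toLp_injective (p := 2) (𝕜 := ℂ) μ ?_
    rw [← ContinuousLinearMap.integral_comp_comm _ (integrable_of_continuous hcont), map_zero]
    simp only [map_smul, toLp_leftTranslate]
    exact h.integral_smul_unitaryRep_eq_zero (isContinuousUnitaryRep_regularRep μ) hf _
  have hInt : ∫ g, ‖f g‖ ^ 2 ∂μ = 0 := by
    have heval := congrArg (ContinuousMap.evalCLM ℂ (1 : G)) hzero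
    rw [← ContinuousLinearMap.integral_comp_comm _ (integrable_of_continuous hcont)] at heval
    refine Complex.ofReal_injective (Eq.trans ?_ heval)
    rw [← integral_complex_ofReal]
    refine integral_congr_ae (Filter.Eventually.of_forall fun g => ?_)
    simp [leftTranslate, w, Complex.conj_mul']
  have hsq : (fun g => ‖f g‖ ^ 2) = 0 := (Continuous.ae_eq_iff_eq μ (by fun_prop)
    continuous_zero).1 ((integral_eq_zero_iff_of_nonneg (fun g => by positivity)
      (integrable_of_continuous (by fun_prop))).1 hInt)
  ext g
  simpa using congrFun hsq g

end PeterWeyl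

section Conjugation

variable {G : Type*} [Group G]
  {H : Type*} [NormedAddCommGroup H] [InnerProductSpace ℂ H] [CompleteSpace H]
  {U : UnitaryRep G H}

theorem conjBy_apply (g : G) (S : H →L[ℂ] H) (x : H) :
    conjBy U g S x = (U g).1 (S ((U g⁻¹).1 x)) := by
  rw [← star_unitaryRep]; rfl

theorem conjBy_eq_conjStarAlgAut (g : G) (S : H →L[ℂ] H) :
    conjBy U g S = Unitary.conjStarAlgAut ℂ (H →L[ℂ] H) (U g) S :=
  (Unitary.conjStarAlgAut_apply _ _).symm

theorem conjBy_mul (g : G) (S T : H →L[ℂ] H) :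
    conjBy U g (S * T) = conjBy U g S * conjBy U g T := by
  simp only [conjBy_eq_conjStarAlgAut, map_mul]

theorem conjBy_star (g : G) (S : H →L[ℂ] H) : conjBy U g (star S) = star (conjBy U g S) := by
  simp only [conjBy, star_mul, star_star, mul_assoc]

theorem conjBy_sum {ι : Type*} (s : Finset ι) (g : G) (S : ι → H →L[ℂ] H) :
    conjBy U g (∑ i ∈ s, S i) = ∑ i ∈ s, conjBy U g (S i) := by
  simp only [conjBy_eq_conjStarAlgAut, map_sum]

theorem conjBy_conjBy (g h : G) (S : H →L[ℂ] H) :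
    conjBy U g (conjBy U h S) = conjBy U (g * h) S := by
  simp only [conjBy_eq_conjStarAlgAut, map_mul, StarAlgEquiv.mul_apply]

theorem conjBy_one (g : G) : conjBy U g 1 = 1 := by
  rw [conjBy_eq_conjStarAlgAut, map_one]

/-- The vector `x` is invariant under the representation `U`. -/
def IsFixedVector (U : UnitaryRep G H) (x : H) : Prop :=
  ∀ g, (U g).1 x = x

end Conjugation

section OrthonormalSums

variable {ι κ : Type*} [Fintype ι] [Fintype κ]
  {E : Type*} [NormedAddCommGroup E] [InnerProductSpace ℂ E]

theorem sum_inner_smul_map {X : Type*} [AddCommGroup X] [Module ℂ X]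
    (e : OrthonormalBasis ι ℂ E) (L : E →ₗ[ℂ] X) (v : E) :
    ∑ i, ⟪e i, v⟫_ℂ • L (e i) = L v := by
  simp only [← map_smul, ← map_sum, e.sum_repr']

theorem sum_map_mul_star_map_eq {X : Type*} [NonUnitalRing X] [StarRing X] [Module ℂ X]
    [StarModule ℂ X] [IsScalarTower ℂ X X] [SMulCommClass ℂ X X]
    (e : OrthonormalBasis ι ℂ E) (f : OrthonormalBasis κ ℂ E) (L M : E →ₗ[ℂ] X) :
    ∑ i, L (e i) * star (M (e i)) = ∑ j, L (f j) * star (M (f j)) := by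
  calc ∑ i, L (e i) * star (M (e i))
      = ∑ i, ∑ j, L (f j) * star (⟪e i, f j⟫_ℂ • M (e i)) := by
        refine Finset.sum_congr rfl fun i _ => ?_
        rw [← sum_inner_smul_map f L (e i), Finset.sum_mul]
        refine Finset.sum_congr rfl fun j _ => ?_
        rw [star_smul, mul_smul_comm, smul_mul_assoc, ← inner_conj_symm]; rfl
    _ = ∑ j, L (f j) * star (M (f j)) := by
        rw [Finset.sum_comm]
        simp only [← Finset.mul_sum, ← star_sum, sum_inner_smul_map e]

end OrthonormalSums

section Multiplets

variable {G : Type*} [Group G]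
  {H : Type*} [NormedAddCommGroup H] [InnerProductSpace ℂ H] [CompleteSpace H]
  {U : UnitaryRep G H} {B : NonUnitalStarSubalgebra ℂ (H →L[ℂ] H)} {n : ℕ}
  {σ : UnitaryRep G (EuclideanSpace ℂ (Fin n))} {L T : EuclideanSpace ℂ (Fin n) →ₗ[ℂ] B}

/-- `L` intertwines `σ` with the action induced by `U`. -/
def IsTensorOperator (U : UnitaryRep G H) (σ : UnitaryRep G (EuclideanSpace ℂ (Fin n)))
    (L : EuclideanSpace ℂ (Fin n) →ₗ[ℂ] B) : Prop :=
  ∀ g v, conjBy U g (L v : H →L[ℂ] H) = L ((σ g).1 v)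

/-- A multiplet: `T` is a unitary equivalence of `σ` with the restriction of the action induced by
`U` to a Hilbert space in `B`, the range of `T`. -/
structure IsMultiplet (U : UnitaryRep G H) (σ : UnitaryRep G (EuclideanSpace ℂ (Fin n)))
    (T : EuclideanSpace ℂ (Fin n) →ₗ[ℂ] B) : Prop where
  star_mul : ∀ v w, star (T v : H →L[ℂ] H) * (T w : H →L[ℂ] H) = ⟪v, w⟫_ℂ • (1 : H →L[ℂ] H)
  isTensorOperator : IsTensorOperator U σ T

/-- The sum `∑ L(eᵢ) T(eᵢ)*` over an orthonormal basis. If `T` is a multiplet, multiplying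
it by `T v` from the right gives back `L v`. -/
def multipletSum (L T : EuclideanSpace ℂ (Fin n) →ₗ[ℂ] B) : B :=
  ∑ i, L (EuclideanSpace.basisFun (Fin n) ℂ i) * star (T (EuclideanSpace.basisFun (Fin n) ℂ i))

theorem coe_multipletSum (L T : EuclideanSpace ℂ (Fin n) →ₗ[ℂ] B) :
    (multipletSum L T : H →L[ℂ] H) = ∑ i, (L (EuclideanSpace.basisFun (Fin n) ℂ i) : H →L[ℂ] H) *
      star (T (EuclideanSpace.basisFun (Fin n) ℂ i) : H →L[ℂ] H) := by
  rw [multipletSum, AddSubmonoidClass.coe_finsetSum]; rfl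

theorem IsTensorOperator.multipletSum_mem_fixedPointAlgebra (hL : IsTensorOperator U σ L)
    (hT : IsTensorOperator U σ T) :
    (multipletSum L T : H →L[ℂ] H) ∈ fixedPointAlgebra U B := by
  refine ⟨(multipletSum L T).2, fun g => ?_⟩
  rw [coe_multipletSum, conjBy_sum]
  simp only [conjBy_mul, conjBy_star, hL g _, hT g _]
  have := sum_map_mul_star_map_eq ((EuclideanSpace.basisFun (Fin n) ℂ).map
    (Unitary.linearIsometryEquiv (σ g))) (EuclideanSpace.basisFun (Fin n) ℂ) L T
  simpa only [AddSubmonoidClass.coe_finsetSum] using! congrArg (fun b : B => (b : H →L[ℂ] H)) this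

theorem IsMultiplet.multipletSum_mul (hT : IsMultiplet U σ T)
    (L : EuclideanSpace ℂ (Fin n) →ₗ[ℂ] B) (v : EuclideanSpace ℂ (Fin n)) :
    multipletSum L T * T v = L v := by
  ext1
  rw [← sum_inner_smul_map (EuclideanSpace.basisFun (Fin n) ℂ) L v, MulMemClass.coe_mul,
    coe_multipletSum, Finset.sum_mul, AddSubmonoidClass.coe_finsetSum]
  refine Finset.sum_congr rfl fun i _ => ?_
  rw [mul_assoc, hT.star_mul, mul_smul_comm, mul_one]
  rfl

theorem star_multipletSum (L T : EuclideanSpace ℂ (Fin n) →ₗ[ℂ] B) :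
    star (multipletSum L T) = multipletSum T L := by
  simp only [multipletSum, star_sum, star_mul, star_star]

/-- The canonical endomorphism `D ↦ ∑ ψᵢ D ψᵢ*` implemented by a multiplet. -/
def multipletEndo (T : EuclideanSpace ℂ (Fin n) →ₗ[ℂ] B) (D : B) : B :=
  multipletSum ((LinearMap.mulRight ℂ D).comp T) T

theorem IsMultiplet.multipletEndo_mul (hT : IsMultiplet U σ T) (D : B)
    (v : EuclideanSpace ℂ (Fin n)) : multipletEndo T D * T v = T v * D :=
  hT.multipletSum_mul _ v

theorem star_multipletEndo (T : EuclideanSpace ℂ (Fin n) →ₗ[ℂ] B) (D : B) :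
    star (multipletEndo T D) = multipletEndo T (star D) := by
  simp only [multipletEndo, multipletSum, LinearMap.comp_apply, LinearMap.mulRight_apply,
    star_sum, star_mul, star_star, mul_assoc]

theorem IsMultiplet.star_mul_multipletEndo (hT : IsMultiplet U σ T) (D : B)
    (v : EuclideanSpace ℂ (Fin n)) : star (T v) * multipletEndo T D = D * star (T v) := by
  rw [← star_star D, ← star_multipletEndo, ← StarMul.star_mul, hT.multipletEndo_mul,
    StarMul.star_mul]

theorem IsTensorOperator.multipletEndo_mem_fixedPointAlgebra (hT : IsTensorOperator U σ T) {D : B}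
    (hD : (D : H →L[ℂ] H) ∈ fixedPointAlgebra U B) :
    (multipletEndo T D : H →L[ℂ] H) ∈ fixedPointAlgebra U B := by
  refine IsTensorOperator.multipletSum_mem_fixedPointAlgebra (fun g v => ?_) hT
  change conjBy U g ((T v : H →L[ℂ] H) * (D : H →L[ℂ] H)) = T ((σ g).1 v) * (D : H →L[ℂ] H)
  rw [conjBy_mul, hT, hD.2]

variable [TopologicalSpace G]

theorem HasFullHilbertSpectrum.exists_isMultiplet (h : HasFullHilbertSpectrum U B)
    (hσ : IsIrreducibleRep σ) :
    ∃ T : EuclideanSpace ℂ (Fin n) →ₗ[ℂ] B, IsMultiplet U σ T := by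
  obtain ⟨E, hE, T, hmul, hequiv⟩ := h n σ hσ.continuous hσ.irreducible
  exact ⟨(Submodule.inclusion (p' := B.toSubmodule) hE.mem).comp T.toLinearMap, hmul, hequiv⟩

theorem IsContinuousUnitaryRep.isIrreducibleRep_of_dim_one
    {σ : UnitaryRep G (EuclideanSpace ℂ (Fin 1))} (hσ : IsContinuousUnitaryRep σ) :
    IsIrreducibleRep σ where
  continuous := hσ
  irreducible := by
    have : IsSimpleModule ℂ (EuclideanSpace ℂ (Fin 1)) :=
      isSimpleModule_iff_finrank_eq_one.2 (by simp)
    exact ⟨inferInstance, fun M _ _ => eq_bot_or_eq_top M⟩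

theorem HasFullHilbertSpectrum.one_mem (h : HasFullHilbertSpectrum U B) :
    (1 : H →L[ℂ] H) ∈ B := by
  obtain ⟨T, hT⟩ := h.exists_isMultiplet
    (IsContinuousUnitaryRep.isIrreducibleRep_of_dim_one (σ := 1) fun _ => continuous_const)
  have hone := hT.star_mul (EuclideanSpace.single 0 1) (EuclideanSpace.single 0 1)
  rw [EuclideanSpace.inner_single_left, PiLp.single_apply, if_pos rfl, map_one, mul_one,
    one_smul] at hone
  exact hone ▸ mul_mem (star_mem (T _).2) (T _).2

theorem HasFullHilbertSpectrum.one_mem_fixedPointAlgebra (h : HasFullHilbertSpectrum U B) :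
    1 ∈ fixedPointAlgebra U B :=
  ⟨h.one_mem, conjBy_one⟩

end Multiplets

section Averages

variable {G : Type*} [Group G] [TopologicalSpace G]
  {H : Type*} [NormedAddCommGroup H] [InnerProductSpace ℂ H] [CompleteSpace H]
  {U : UnitaryRep G H} {B : NonUnitalStarSubalgebra ℂ (H →L[ℂ] H)}

/-- The automorphism of `B` induced by `U g`. -/
def InducesAction.act (hα : InducesAction U B) (g : G) : B →L[ℂ] B :=
  (ContinuousLinearMap.mulLeftRight ℂ (H →L[ℂ] H) (U g).1 (star (U g).1) ∘L
    B.toSubmodule.subtypeL).codRestrict B.toSubmodule fun b => hα.mem g b b.2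

theorem InducesAction.coe_act (hα : InducesAction U B) (g : G) (b : B) :
    (hα.act g b : H →L[ℂ] H) = conjBy U g b := rfl

theorem InducesAction.act_act (hα : InducesAction U B) (g h : G) (b : B) :
    hα.act g (hα.act h b) = hα.act (g * h) b :=
  Subtype.ext (conjBy_conjBy g h _)

theorem InducesAction.act_one (hα : InducesAction U B) (b : B) : hα.act 1 b = b :=
  Subtype.ext (by simp [coe_act, conjBy])

theorem InducesAction.continuous_act (hα : InducesAction U B) (b : B) :
    Continuous fun g => hα.act g b :=
  (hα.continuous b b.2).subtype_mk _

theorem InducesAction.coe_mem_fixedPointAlgebra (hα : InducesAction U B) {b : B}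
    (hb : ∀ g, hα.act g b = b) : (b : H →L[ℂ] H) ∈ fixedPointAlgebra U B :=
  ⟨b.2, fun g => congrArg Subtype.val (hb g)⟩

variable [MeasurableSpace G]

/-- The weighted average `∫ φ(g) α_g(c) dg` over the group. -/
def InducesAction.average (hα : InducesAction U B) (μ : Measure G) (φ : G → ℂ) (c : B) : B :=
  ∫ g, φ g • hα.act g c ∂μ

variable [CompactSpace G] [BorelSpace G] {μ : Measure G} [IsFiniteMeasureOnCompacts μ]

theorem InducesAction.map_average (hα : InducesAction U B)
    (hB : IsClosed (B : Set (H →L[ℂ] H))) {φ : G → ℂ} (hφ : Continuous φ) (c : B)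
    {E : Type*} [NormedAddCommGroup E] [NormedSpace ℂ E] [CompleteSpace E] (Λ : B →L[ℂ] E) :
    Λ (hα.average μ φ c) = ∫ g, φ g • Λ (hα.act g c) ∂μ := by
  have : CompleteSpace B := hB.completeSpace_coe
  rw [average, ← Λ.integral_comp_comm
    (integrable_of_continuous (hφ.fun_smul (hα.continuous_act c)))]
  simp only [map_smul]

theorem InducesAction.act_average [IsTopologicalGroup G] [μ.IsMulLeftInvariant]
    (hα : InducesAction U B) (hB : IsClosed (B : Set (H →L[ℂ] H))) {φ : G → ℂ}
    (hφ : Continuous φ) (c : B) (h : G) :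
    hα.act h (hα.average μ φ c) = hα.average μ (fun g => φ (h⁻¹ * g)) c := by
  have : CompleteSpace B := hB.completeSpace_coe
  rw [hα.map_average hB hφ, average,
    ← integral_mul_left_eq_self (fun g => φ (h⁻¹ * g) • hα.act g c) h]
  simp only [act_act, inv_mul_cancel_left]

theorem InducesAction.average_one_mem_fixedPointAlgebra [IsTopologicalGroup G]
    [μ.IsMulLeftInvariant] (hα : InducesAction U B) (hB : IsClosed (B : Set (H →L[ℂ] H))) (c : B) :
    (hα.average μ 1 c : H →L[ℂ] H) ∈ fixedPointAlgebra U B :=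
  hα.coe_mem_fixedPointAlgebra fun g => hα.act_average hB continuous_const c g

theorem InducesAction.inner_average_one_apply (hα : InducesAction U B)
    (hB : IsClosed (B : Set (H →L[ℂ] H))) (c : B) (x y : H) :
    ⟪x, (hα.average μ 1 c : H →L[ℂ] H) y⟫_ℂ = ∫ g, ⟪x, conjBy U g c y⟫_ℂ ∂μ := by
  simpa using! hα.map_average (μ := μ) hB continuous_one c
    (innerSL ℂ x ∘L ContinuousLinearMap.apply ℂ H y ∘L B.toSubmodule.subtypeL)

variable {n : ℕ} {σ : UnitaryRep G (EuclideanSpace ℂ (Fin n))}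

/-- The component `v ↦ ∫ ⟪σ(g) w, v⟫ α_g(c) dg` of `c` in the spectral subspace of `σ`. -/
def spectralComponent (μ : Measure G) [IsFiniteMeasureOnCompacts μ] (hα : InducesAction U B)
    (hσ : IsContinuousUnitaryRep σ) (w : EuclideanSpace ℂ (Fin n)) (c : B) :
    EuclideanSpace ℂ (Fin n) →ₗ[ℂ] B where
  toFun v := hα.average μ (fun g => ⟪(σ g).1 w, v⟫_ℂ) c
  map_add' v v' := by
    simp only [InducesAction.average, inner_add_right, add_smul]
    have hInt : ∀ u, Integrable (fun g => ⟪(σ g).1 w, u⟫_ℂ • hα.act g c) μ := fun u =>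
      integrable_of_continuous (((hσ w).inner continuous_const).fun_smul (hα.continuous_act c))
    exact integral_add (hInt v) (hInt v')
  map_smul' a v := by
    simp only [InducesAction.average, inner_smul_right, mul_smul, integral_smul, RingHom.id_apply]

variable [IsTopologicalGroup G]

theorem isTensorOperator_spectralComponent [μ.IsMulLeftInvariant]
    (hB : IsClosed (B : Set (H →L[ℂ] H))) (hα : InducesAction U B) (hσ : IsContinuousUnitaryRep σ)
    (w : EuclideanSpace ℂ (Fin n)) (c : B) :
    IsTensorOperator U σ (spectralComponent μ hα hσ w c) := fun h v => by
  refine congrArg Subtype.val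
    ((hα.act_average hB ((hσ w).inner continuous_const) c h).trans ?_)
  simp only [unitaryRep_mul_apply, inner_unitaryRep_left σ h⁻¹, inv_inv]
  rfl

end Averages

section SpectralTotality

variable {G : Type*} [Group G] [TopologicalSpace G] [IsTopologicalGroup G] [CompactSpace G]
  {H : Type*} [NormedAddCommGroup H] [InnerProductSpace ℂ H] [CompleteSpace H]
  {U : UnitaryRep G H} {B : NonUnitalStarSubalgebra ℂ (H →L[ℂ] H)}

-- `D * T v` ranges over the spectral subspaces of the action, which are total by Peter–Weyl.
theorem HasFullHilbertSpectrum.clm_eq_zero (hfull : HasFullHilbertSpectrum U B)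
    (hB : IsClosed (B : Set (H →L[ℂ] H))) (hα : InducesAction U B) {Λ : B →L[ℂ] ℂ}
    (hΛ : ∀ (n : ℕ) (σ : UnitaryRep G (EuclideanSpace ℂ (Fin n)))
      (T : EuclideanSpace ℂ (Fin n) →ₗ[ℂ] B), IsIrreducibleRep σ → IsMultiplet U σ T →
      ∀ D : B, (D : H →L[ℂ] H) ∈ fixedPointAlgebra U B → ∀ v, Λ (D * T v) = 0) : Λ = 0 := by
  borelize G
  obtain ⟨μ, _, _⟩ := exists_isHaarMeasure_isProbabilityMeasure G
  ext c
  have hf : Continuous fun g => Λ (hα.act g c) := Λ.continuous.comp (hα.continuous_act c)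
  have horth : IsOrthogonalToCoeffs μ fun g => Λ (hα.act g c) := fun n σ hσ v w => by
    obtain ⟨T, hT⟩ := hfull.exists_isMultiplet hσ
    have hL := isTensorOperator_spectralComponent (μ := μ) hB hα hσ.continuous w c
    calc ∫ g, Λ (hα.act g c) * ⟪(σ g).1 w, v⟫_ℂ ∂μ
        = Λ (spectralComponent μ hα hσ.continuous w c v) := by
          refine Eq.trans ?_
            (hα.map_average hB ((hσ.continuous w).inner continuous_const) c Λ).symm
          simp only [smul_eq_mul, mul_comm]
      _ = 0 := by
          rw [← hT.multipletSum_mul]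
          exact hΛ n σ T hσ hT _ (hL.multipletSum_mem_fixedPointAlgebra hT.isTensorOperator) v
  simpa only [hα.act_one] using! congrFun (horth.eq_zero hf) 1

end SpectralTotality

section MultipletVectors

variable {G : Type*} [Group G]
  {H : Type*} [NormedAddCommGroup H] [InnerProductSpace ℂ H] [CompleteSpace H]
  {U : UnitaryRep G H} {B : NonUnitalStarSubalgebra ℂ (H →L[ℂ] H)} {n : ℕ}
  {σ : UnitaryRep G (EuclideanSpace ℂ (Fin n))} {T : EuclideanSpace ℂ (Fin n) →ₗ[ℂ] B}

theorem IsTensorOperator.unitaryRep_apply (hT : IsTensorOperator U σ T) (g : G)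
    (v : EuclideanSpace ℂ (Fin n)) (x : H) :
    (U g).1 ((T v : H →L[ℂ] H) x) = (T ((σ g).1 v) : H →L[ℂ] H) ((U g).1 x) := by
  rw [← hT, conjBy_apply, unitaryRep_inv_apply_self]

theorem inner_star_apply (S : H →L[ℂ] H) (x y : H) : ⟪star S x, y⟫_ℂ = ⟪x, S y⟫_ℂ :=
  ContinuousLinearMap.adjoint_inner_left S y x

theorem IsMultiplet.inner_apply_apply (hT : IsMultiplet U σ T) (v w : EuclideanSpace ℂ (Fin n))
    (x y : H) : ⟪(T v : H →L[ℂ] H) x, (T w : H →L[ℂ] H) y⟫_ℂ = ⟪v, w⟫_ℂ * ⟪x, y⟫_ℂ := by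
  rw [← ContinuousLinearMap.adjoint_inner_right, ← ContinuousLinearMap.star_eq_adjoint,
    ← mul_apply_eq_comp, hT.star_mul, smul_apply, one_apply_eq_self, inner_smul_right]

end MultipletVectors

section FixedVectors

variable {G : Type*} [Group G] [TopologicalSpace G] [IsTopologicalGroup G] [CompactSpace G]
  {H : Type*} [NormedAddCommGroup H] [InnerProductSpace ℂ H] [CompleteSpace H]
  {U : UnitaryRep G H} {B : NonUnitalStarSubalgebra ℂ (H →L[ℂ] H)}

theorem isFixedVector_integral [MeasurableSpace G] [BorelSpace G] {μ : Measure G}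
    [IsFiniteMeasureOnCompacts μ] [μ.IsMulLeftInvariant] (hU : IsContinuousUnitaryRep U) (x : H) :
    IsFixedVector U (∫ g, (U g).1 x ∂μ) := fun h => by
  rw [← ContinuousLinearMap.integral_comp_comm _ (integrable_of_continuous (hU x)),
    ← integral_mul_left_eq_self (fun g => (U g).1 x) h]
  simp only [unitaryRep_mul_apply]

-- Otherwise every integral `∫ U(g) y dg` vanishes, in particular for `y = T w x`; the inner product
-- of `U(g) T w x = T (σ(g) w) U(g) x` with `T v x` is `⟪σ(g) w, v⟫ ⟪U(g) x, x⟫`.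
theorem HasFullHilbertSpectrum.exists_isFixedVector_ne_zero [Nontrivial H]
    (hfull : HasFullHilbertSpectrum U B) (hU : IsContinuousUnitaryRep U) :
    ∃ x, IsFixedVector U x ∧ x ≠ 0 := by
  borelize G
  obtain ⟨μ, _, _⟩ := exists_isHaarMeasure_isProbabilityMeasure G
  by_contra! hcon
  obtain ⟨x, hx⟩ := exists_ne (0 : H)
  have hf : Continuous fun g => ⟪(U g).1 x, x⟫_ℂ := (hU x).inner continuous_const
  have horth : IsOrthogonalToCoeffs μ fun g => ⟪(U g).1 x, x⟫_ℂ := fun n σ hσ v w => by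
    obtain ⟨T, hT⟩ := hfull.exists_isMultiplet hσ
    rw [← map_zero (starRingEnd ℂ), ← inner_zero_right ((T v : H →L[ℂ] H) x),
      ← hcon _ (isFixedVector_integral (μ := μ) hU ((T w : H →L[ℂ] H) x)),
      ← integral_inner (integrable_of_continuous (hU _)), ← integral_conj]
    refine integral_congr_ae (Filter.Eventually.of_forall fun g => ?_)
    simp only
    rw [inner_conj_symm, hT.isTensorOperator.unitaryRep_apply, hT.inner_apply_apply, mul_comm]
  have hzero := congrFun (horth.eq_zero hf) 1
  rw [unitaryRep_one_apply] at hzero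
  exact hx (inner_self_eq_zero.1 hzero)

end FixedVectors

section Eigenvectors

variable {G : Type*} [Group G]
  {H : Type*} [NormedAddCommGroup H] [InnerProductSpace ℂ H] [CompleteSpace H]
  {U : UnitaryRep G H} {B : NonUnitalStarSubalgebra ℂ (H →L[ℂ] H)}

theorem conjBy_rankOne_self {x : H} (hx : IsFixedVector U x) (g : G) :
    conjBy U g (InnerProductSpace.rankOne ℂ x x) = InnerProductSpace.rankOne ℂ x x := by
  ext y
  rw [conjBy_apply, InnerProductSpace.rankOne_apply, InnerProductSpace.rankOne_apply, map_smul,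
    hx, inner_unitaryRep_right, inv_inv, hx]

variable [TopologicalSpace G] [IsTopologicalGroup G] [CompactSpace G]

theorem exists_integral_inner_conjBy_eq_sum [MeasurableSpace G] [BorelSpace G] (μ : Measure G)
    [IsFiniteMeasureOnCompacts μ] (hU : IsContinuousUnitaryRep U) {n : ℕ}
    {σ : UnitaryRep G (EuclideanSpace ℂ (Fin n))} (hσ : IsContinuousUnitaryRep σ)
    {J : EuclideanSpace ℂ (Fin n) →ₗᵢ[ℂ] H} (hJ : ∀ g v, (U g).1 (J v) = J ((σ g).1 v))
    (v : EuclideanSpace ℂ (Fin n)) (y : H) :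
    ∃ u z : Fin n → H, ∀ T : H →L[ℂ] H,
      ∫ g, ⟪J v, conjBy U g T y⟫_ℂ ∂μ = ∑ i, ⟪u i, T (z i)⟫_ℂ := by
  let e := EuclideanSpace.basisFun (Fin n) ℂ
  let φ : Fin n → G → H := fun i g => ⟪(σ g⁻¹).1 v, e i⟫_ℂ • (U g⁻¹).1 y
  have hφ : ∀ i, Integrable (φ i) μ := fun i => integrable_of_continuous
    ((((hσ v).comp continuous_inv).inner continuous_const).fun_smul ((hU y).comp continuous_inv))
  refine ⟨fun i => J (e i), fun i => ∫ g, φ i g ∂μ, fun T => ?_⟩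
  calc ∫ g, ⟪J v, conjBy U g T y⟫_ℂ ∂μ
      = ∫ g, ∑ i, ⟪J (e i), T (φ i g)⟫_ℂ ∂μ := by
        refine integral_congr_ae (Filter.Eventually.of_forall fun g => ?_)
        simp only [φ]
        rw [conjBy_apply, inner_unitaryRep_right, hJ, ← e.sum_repr' ((σ g⁻¹).1 v), map_sum,
          sum_inner]
        simp only [map_smul, inner_smul_left, inner_conj_symm, inner_smul_right, e.sum_repr']
    _ = ∑ i, ∫ g, ⟪J (e i), T (φ i g)⟫_ℂ ∂μ :=
        integral_finsetSum _ fun i _ => (T.integrable_comp (hφ i)).const_inner _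
    _ = ∑ i, ⟪J (e i), T (∫ g, φ i g ∂μ)⟫_ℂ := by
        refine Finset.sum_congr rfl fun i _ => ?_
        rw [← T.integral_comp_comm (hφ i), ← integral_inner (T.integrable_comp (hφ i))]

theorem IsFixedVector.exists_integral_inner_conjBy_eq_inner [MeasurableSpace G] [BorelSpace G]
    (μ : Measure G) [IsFiniteMeasureOnCompacts μ] (hU : IsContinuousUnitaryRep U) {x : H}
    (hx : IsFixedVector U x) (y : H) :
    ∃ p, ∀ T : H →L[ℂ] H, ∫ g, ⟪y, conjBy U g T x⟫_ℂ ∂μ = ⟪p, T x⟫_ℂ := by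
  have hInt : Integrable (fun g => (U g⁻¹).1 y) μ :=
    integrable_of_continuous ((hU y).comp continuous_inv)
  refine ⟨∫ g, (U g⁻¹).1 y ∂μ, fun T => ?_⟩
  have hfixed : ∀ g, ⟪y, conjBy U g T x⟫_ℂ = ⟪(U g⁻¹).1 y, T x⟫_ℂ := fun g => by
    rw [conjBy_apply, hx, inner_unitaryRep_right]
  simp only [hfixed]
  rw [← inner_conj_symm, ← integral_inner hInt, ← integral_conj]
  simp only [inner_conj_symm]

-- For `v` in the space of an irreducible subrepresentation, both sides of
-- `⟪C* v, b̄ x⟫ = ⟪v, b̄ (C x)⟫`, `b̄` the average of `b`, are finite sums of vector functionals of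
-- `b ∈ B`. Hence they agree on all of `B(H)`, in particular on `|x⟩⟨x|`.
theorem IsFixedVector.exists_apply_eq_smul_of_commute {x : H} (hx : IsFixedVector U x)
    (hB : IsClosed (B : Set (H →L[ℂ] H))) (hirr : ActsIrreducibly (B : Set (H →L[ℂ] H)))
    (h1 : 1 ∈ B) (hU : IsContinuousUnitaryRep U) (hα : InducesAction U B) {C : H →L[ℂ] H}
    (hC : ∀ D ∈ fixedPointAlgebra U B, Commute D C) : ∃ c : ℂ, C x = c • x := by
  borelize G
  obtain ⟨μ, _, _⟩ := exists_isHaarMeasure_isProbabilityMeasure G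
  obtain rfl | hx0 := eq_or_ne x 0
  · exact ⟨0, by simp⟩
  suffices h : ⟪x, x⟫_ℂ • C x - ⟪x, C x⟫_ℂ • x = 0 from
    ⟨⟪x, C x⟫_ℂ / ⟪x, x⟫_ℂ, by
      rw [div_eq_inv_mul, mul_smul, ← sub_eq_zero.1 h, inv_smul_smul₀ (inner_self_ne_zero.2 hx0)]⟩
  refine hU.eq_zero_of_forall_inner_eq_zero fun n σ J hσ hJ v => ?_
  obtain ⟨p, hp⟩ := hx.exists_integral_inner_conjBy_eq_inner μ hU (star C (J v))
  obtain ⟨u, z, huz⟩ := exists_integral_inner_conjBy_eq_sum μ hU hσ.continuous hJ v (C x)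
  have hmem : ∀ b ∈ B, ⟪p, b x⟫_ℂ = ∑ i, ⟪u i, b (z i)⟫_ℂ := fun b hb => by
    rw [← hp, ← huz, ← hα.inner_average_one_apply hB ⟨b, hb⟩,
      ← hα.inner_average_one_apply hB ⟨b, hb⟩, inner_star_apply, ← mul_apply_eq_comp,
      ← mul_apply_eq_comp, (hC _ (hα.average_one_mem_fixedPointAlgebra hB ⟨b, hb⟩)).eq]
  have hall : ∀ T : H →L[ℂ] H, ⟪p, T x⟫_ℂ = ∑ i, ⟪u i, T (z i)⟫_ℂ := fun T => by
    simpa [Fintype.sum_option, neg_add_eq_zero] using hirr.sum_inner_eq_zero h1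
      (u := fun o : Option (Fin n) => o.elim (-p) u) (z := fun o => o.elim x z)
      (by simpa [Fintype.sum_option, neg_add_eq_zero] using hmem) T
  have hrank := hall (InnerProductSpace.rankOne ℂ x x)
  rw [← hp, ← huz] at hrank
  simp only [conjBy_rankOne_self hx, integral_const, probReal_univ, one_smul, inner_star_apply,
    InnerProductSpace.rankOne_apply, inner_smul_right] at hrank
  rw [inner_sub_right, inner_smul_right, inner_smul_right, hrank, sub_self]

end Eigenvectors

section NontrivialTensorOperators

variable {G : Type*} [Group G]
  {H : Type*} [NormedAddCommGroup H] [InnerProductSpace ℂ H] [CompleteSpace H]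
  {U : UnitaryRep G H} {B : NonUnitalStarSubalgebra ℂ (H →L[ℂ] H)} {n : ℕ}
  {σ : UnitaryRep G (EuclideanSpace ℂ (Fin n))} {T : EuclideanSpace ℂ (Fin n) →ₗ[ℂ] B}

theorem IsFixedVector.apply_of_mem_fixedPointAlgebra {x : H} (hx : IsFixedVector U x)
    {D : H →L[ℂ] H} (hD : D ∈ fixedPointAlgebra U B) : IsFixedVector U (D x) := fun g => by
  conv_rhs => rw [← hD.2 g, conjBy_apply, hx]

-- `v ↦ ⟪y, T v x⟫` is an invariant functional on the space of `σ`, so its kernel is invariant.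
theorem IsTensorOperator.inner_apply_eq_zero [TopologicalSpace G] (hT : IsTensorOperator U σ T)
    (hσ : IsIrreducibleRep σ) (hne : σ ≠ 1) {x y : H} (hx : IsFixedVector U x)
    (hy : IsFixedVector U y) (v : EuclideanSpace ℂ (Fin n)) :
    ⟪y, (T v : H →L[ℂ] H) x⟫_ℂ = 0 := by
  let ℓ : EuclideanSpace ℂ (Fin n) →ₗ[ℂ] ℂ :=
    (innerSL ℂ y ∘L ContinuousLinearMap.apply ℂ H x ∘L B.toSubmodule.subtypeL).toLinearMap ∘ₗ T
  have hinv : ∀ g w, ℓ ((σ g).1 w) = ℓ w := fun g w => by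
    change ⟪y, (T ((σ g).1 w) : H →L[ℂ] H) x⟫_ℂ = ⟪y, (T w : H →L[ℂ] H) x⟫_ℂ
    rw [← hT, conjBy_apply, hx, inner_unitaryRep_right, hy]
  obtain hbot | htop := hσ.irreducible.2 (LinearMap.ker ℓ)
    (Submodule.closed_of_finiteDimensional _) (by
      rintro _ ⟨g, rfl⟩ w hw
      exact (hinv g w).trans hw)
  · refine absurd ?_ hne
    exact MonoidHom.ext fun g => Subtype.ext (ContinuousLinearMap.ext fun w =>
      LinearMap.ker_eq_bot.1 hbot (hinv g w))
  · exact LinearMap.congr_fun (LinearMap.ker_eq_top.1 htop) v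

end NontrivialTensorOperators

section Intertwiners

variable {H : Type*} [NormedAddCommGroup H] [InnerProductSpace ℂ H] [CompleteSpace H]
  {K : Type*} [NormedAddCommGroup K] [InnerProductSpace ℂ K] [CompleteSpace K]
  {A B : NonUnitalStarSubalgebra ℂ (H →L[ℂ] H)} {π : B →⋆ₙₐ[ℂ] (K →L[ℂ] K)} {S S' : H →L[ℂ] K}

/-- `S` intertwines the identical representation with `π` on the elements of `B` lying in `A`. -/
def IntertwinesOn (A : NonUnitalStarSubalgebra ℂ (H →L[ℂ] H)) (π : B →⋆ₙₐ[ℂ] (K →L[ℂ] K))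
    (S : H →L[ℂ] K) : Prop :=
  ∀ b : B, (b : H →L[ℂ] H) ∈ A → ∀ x, S ((b : H →L[ℂ] H) x) = π b (S x)

/-- A representation of a norm-closed algebra of operators as a continuous linear map. -/
def representationCLM (hB : IsClosed (B : Set (H →L[ℂ] H))) (π : B →⋆ₙₐ[ℂ] (K →L[ℂ] K)) :
    B →L[ℂ] (K →L[ℂ] K) :=
  LinearMap.mkContinuous (LinearMapClass.linearMap π) 1 fun b => by
    have := hB.completeSpace_coe
    rw [one_mul]
    exact NonUnitalStarAlgHom.norm_apply_le π b

theorem inner_map_left (π : B →⋆ₙₐ[ℂ] (K →L[ℂ] K)) (b : B) (y z : K) :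
    ⟪π b y, z⟫_ℂ = ⟪y, π (star b) z⟫_ℂ := by
  rw [map_star, ← inner_star_apply, star_star]

theorem IntertwinesOn.commute_adjoint_comp (hS : IntertwinesOn A π S) (hS' : IntertwinesOn A π S')
    {D : B} (hD : (D : H →L[ℂ] H) ∈ A) : Commute (D : H →L[ℂ] H) (S.adjoint ∘L S') := by
  ext x
  refine ext_inner_left ℂ fun y => ?_
  simp only [mul_apply_eq_comp, ContinuousLinearMap.comp_apply]
  have hstar : S (star (D : H →L[ℂ] H) y) = π (star D) (S y) := hS (star D) (star_mem hD) y
  rw [← inner_star_apply, ContinuousLinearMap.adjoint_inner_right, hstar, inner_map_left, star_star,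
    ContinuousLinearMap.adjoint_inner_right, hS' D hD]

variable {G : Type*} [Group G] {U : UnitaryRep G H} {n : ℕ}
  {σ : UnitaryRep G (EuclideanSpace ℂ (Fin n))} {T : EuclideanSpace ℂ (Fin n) →ₗ[ℂ] B}

theorem IsMultiplet.star_mul_multipletSum (hT : IsMultiplet U σ T) (v : EuclideanSpace ℂ (Fin n)) :
    star (T v) * multipletSum T T = star (T v) := by
  rw [← star_star (multipletSum T T), ← StarMul.star_mul, star_multipletSum, hT.multipletSum_mul]

theorem IntertwinesOn.map_star_comp (hS : IntertwinesOn (fixedPointAlgebra U B) π S)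
    (hT : IsMultiplet U σ T) (v w : EuclideanSpace ℂ (Fin n)) :
    IntertwinesOn (fixedPointAlgebra U B) π (π (star (T v)) ∘L S ∘L (T w : H →L[ℂ] H)) :=
  fun D hD x => by
  have hw : (T w : H →L[ℂ] H) ((D : H →L[ℂ] H) x) =
      (multipletEndo T D : H →L[ℂ] H) ((T w : H →L[ℂ] H) x) :=
    DFunLike.congr_fun (congrArg Subtype.val (hT.multipletEndo_mul D w).symm) x
  simp only [ContinuousLinearMap.comp_apply]
  rw [hw, hS _ (hT.isTensorOperator.multipletEndo_mem_fixedPointAlgebra hD), ← mul_apply_eq_comp,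
    ← map_mul, hT.star_mul_multipletEndo, map_mul, mul_apply_eq_comp]

variable [TopologicalSpace G] [IsTopologicalGroup G] [CompactSpace G]

theorem IntertwinesOn.exists_adjoint_apply_eq_smul (hS : IntertwinesOn (fixedPointAlgebra U B) π S)
    (hS' : IntertwinesOn (fixedPointAlgebra U B) π S') (hB : IsClosed (B : Set (H →L[ℂ] H)))
    (hirr : ActsIrreducibly (B : Set (H →L[ℂ] H))) (h1 : 1 ∈ B) (hU : IsContinuousUnitaryRep U)
    (hα : InducesAction U B) {x : H} (hx : IsFixedVector U x) :
    ∃ c : ℂ, S.adjoint (S' x) = c • x :=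
  hx.exists_apply_eq_smul_of_commute hB hirr h1 hU hα
    fun D hD => hS.commute_adjoint_comp hS' (D := ⟨D, hD.1⟩) hD

theorem IntertwinesOn.inner_map_multiplet_apply_eq_zero
    (hS : IntertwinesOn (fixedPointAlgebra U B) π S) (hB : IsClosed (B : Set (H →L[ℂ] H)))
    (hirr : ActsIrreducibly (B : Set (H →L[ℂ] H))) (h1 : 1 ∈ B) (hU : IsContinuousUnitaryRep U)
    (hα : InducesAction U B) (hT : IsMultiplet U σ T) (hσ : IsIrreducibleRep σ) (hne : σ ≠ 1)
    {x y : H} (hx : IsFixedVector U x) (hy : IsFixedVector U y) (v : EuclideanSpace ℂ (Fin n)) :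
    ⟪S y, π (T v) (S x)⟫_ℂ = 0 := by
  let ψ : Fin n → B := fun k => T (EuclideanSpace.basisFun (Fin n) ℂ k)
  let W : Fin n → H →L[ℂ] K := fun k => π (star (T v)) ∘L S ∘L (ψ k : H →L[ℂ] H)
  have hSy : π (star (T v)) (S y) = ∑ k, W k (star (ψ k : H →L[ℂ] H) y) := by
    rw [← hT.star_mul_multipletSum, map_mul, mul_apply_eq_comp,
      ← hS _ (hT.isTensorOperator.multipletSum_mem_fixedPointAlgebra hT.isTensorOperator),
      coe_multipletSum, sum_apply, map_sum, map_sum]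
    rfl
  rw [← star_star (T v), ← inner_map_left, hSy, sum_inner]
  refine Finset.sum_eq_zero fun k _ => ?_
  obtain ⟨c, hc⟩ := (hS.map_star_comp hT v _).exists_adjoint_apply_eq_smul hS hB hirr h1 hU hα hx
  rw [← ContinuousLinearMap.adjoint_inner_right, hc, inner_star_apply, map_smul, inner_smul_right,
    hT.isTensorOperator.inner_apply_eq_zero hσ hne hx hy, mul_zero]

theorem IntertwinesOn.inner_map_apply_eq (hS : IntertwinesOn (fixedPointAlgebra U B) π S)
    (hB : IsClosed (B : Set (H →L[ℂ] H))) (hirr : ActsIrreducibly (B : Set (H →L[ℂ] H)))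
    (hU : IsContinuousUnitaryRep U) (hα : InducesAction U B) (hfull : HasFullHilbertSpectrum U B)
    {x : H} (hx : IsFixedVector U x) (b : B) :
    ⟪S x, π b (S x)⟫_ℂ = ⟪S.adjoint (S x), (b : H →L[ℂ] H) x⟫_ℂ := by
  let Λ : B →L[ℂ] ℂ :=
    innerSL ℂ (S x) ∘L ContinuousLinearMap.apply ℂ K (S x) ∘L representationCLM hB π -
      innerSL ℂ (S.adjoint (S x)) ∘L ContinuousLinearMap.apply ℂ H x ∘L B.toSubmodule.subtypeL
  have hΛ : Λ = 0 := hfull.clm_eq_zero hB hα fun n σ T hσ hT D hD v => by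
    change ⟪S x, π (D * T v) (S x)⟫_ℂ -
      ⟪S.adjoint (S x), ((D * T v : B) : H →L[ℂ] H) x⟫_ℂ = 0
    obtain rfl | hne := eq_or_ne σ 1
    · have hmem : ((D * T v : B) : H →L[ℂ] H) ∈ fixedPointAlgebra U B :=
        mul_mem hD ⟨(T v).2, fun g => hT.isTensorOperator g v⟩
      rw [← hS _ hmem, ContinuousLinearMap.adjoint_inner_left, sub_self]
    · obtain ⟨c, hc⟩ := hS.exists_adjoint_apply_eq_smul hS hB hirr hfull.one_mem hU hα hx
      have hDx : IsFixedVector U (star (D : H →L[ℂ] H) x) :=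
        hx.apply_of_mem_fixedPointAlgebra (star_mem hD)
      have hSD : π (star D) (S x) = S (star (D : H →L[ℂ] H) x) := (hS (star D) (star_mem hD) x).symm
      rw [map_mul, mul_apply_eq_comp, ← star_star D, ← inner_map_left, hSD,
        hS.inner_map_multiplet_apply_eq_zero hB hirr hfull.one_mem hU hα hT hσ hne hx hDx, hc,
        star_star, inner_smul_left, MulMemClass.coe_mul, mul_apply_eq_comp, ← inner_star_apply,
        hT.isTensorOperator.inner_apply_eq_zero hσ hne hx hDx, mul_zero, sub_self]
  exact sub_eq_zero.1 (DFunLike.congr_fun hΛ b)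

theorem IntertwinesOn.exists_norm_map_apply_le (hS : IntertwinesOn (fixedPointAlgebra U B) π S)
    (hB : IsClosed (B : Set (H →L[ℂ] H))) (hirr : ActsIrreducibly (B : Set (H →L[ℂ] H)))
    (hU : IsContinuousUnitaryRep U) (hα : InducesAction U B) (hfull : HasFullHilbertSpectrum U B)
    {x : H} (hx : IsFixedVector U x) :
    ∃ C : ℝ, ∀ b : B, ‖π b (S x)‖ ≤ C * ‖(b : H →L[ℂ] H) x‖ := by
  obtain ⟨c, hc⟩ := hS.exists_adjoint_apply_eq_smul hS hB hirr hfull.one_mem hU hα hx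
  refine ⟨√‖c‖, fun b => ?_⟩
  have hsq : ⟪π b (S x), π b (S x)⟫_ℂ =
      starRingEnd ℂ c * ⟪(b : H →L[ℂ] H) x, (b : H →L[ℂ] H) x⟫_ℂ := by
    rw [inner_map_left, ← mul_apply_eq_comp, ← map_mul,
      hS.inner_map_apply_eq hB hirr hU hα hfull hx, hc, inner_smul_left]
    exact congrArg _ (ContinuousLinearMap.adjoint_inner_right (b : H →L[ℂ] H) x _)
  refine abs_le_of_sq_le_sq' ?_ (by positivity) |>.2
  rw [mul_pow, Real.sq_sqrt (norm_nonneg c)]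
  refine le_of_eq ?_
  simpa [inner_self_eq_norm_sq_to_K, norm_mul] using congrArg norm hsq

variable {Q : K →L[ℂ] K}

theorem IntertwinesOn.map_fixedVector_eq_zero (hS : IntertwinesOn (fixedPointAlgebra U B) π S)
    (hB : IsClosed (B : Set (H →L[ℂ] H))) (hirr : ActsIrreducibly (B : Set (H →L[ℂ] H)))
    (hU : IsContinuousUnitaryRep U) (hα : InducesAction U B) (hfull : HasFullHilbertSpectrum U B)
    (hW : ∀ W, IntertwinesOn B π W → Q ∘L W = 0) {x : H} (hx : IsFixedVector U x) :
    Q (S x) = 0 := by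
  obtain ⟨C, hC⟩ := hS.exists_norm_map_apply_le hB hirr hU hα hfull hx
  let e : B := ⟨1, hfull.one_mem⟩
  have he : (e : H →L[ℂ] H) ∈ fixedPointAlgebra U B := hfull.one_mem_fixedPointAlgebra
  obtain ⟨V, hV, hVx⟩ := exists_intertwiner_of_norm_le
    (θ := NonUnitalStarSubalgebraClass.subtype B) hC ⟨e, rfl, (hS e he x).symm⟩
  rw [← hVx]
  exact DFunLike.congr_fun (hW V fun b _ ξ => hV b ξ) x

theorem IntertwinesOn.map_multiplet_apply_eq_zero (hS : IntertwinesOn (fixedPointAlgebra U B) π S)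
    (hB : IsClosed (B : Set (H →L[ℂ] H))) (hirr : ActsIrreducibly (B : Set (H →L[ℂ] H)))
    (hU : IsContinuousUnitaryRep U) (hα : InducesAction U B) (hfull : HasFullHilbertSpectrum U B)
    (hQ : ∀ b y, Q (π b y) = π b (Q y)) (hW : ∀ W, IntertwinesOn B π W → Q ∘L W = 0)
    (hT : IsMultiplet U σ T) {x : H} (hx : IsFixedVector U x) (v : EuclideanSpace ℂ (Fin n)) :
    Q (S ((T v : H →L[ℂ] H) x)) = 0 := by
  have hTv : (T v : H →L[ℂ] H) x =
      (multipletSum T T : H →L[ℂ] H) ((T v : H →L[ℂ] H) x) :=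
    DFunLike.congr_fun (congrArg Subtype.val (hT.multipletSum_mul T v).symm) x
  rw [hTv, hS _ (hT.isTensorOperator.multipletSum_mem_fixedPointAlgebra hT.isTensorOperator),
    multipletSum, map_sum, sum_apply, map_sum]
  refine Finset.sum_eq_zero fun k _ => ?_
  rw [map_mul, mul_apply_eq_comp, hQ]
  exact (congrArg _ ((hS.map_star_comp hT _ v).map_fixedVector_eq_zero
    hB hirr hU hα hfull hW hx)).trans (map_zero _)

theorem IntertwinesOn.comp_eq_zero (hS : IntertwinesOn (fixedPointAlgebra U B) π S)
    (hB : IsClosed (B : Set (H →L[ℂ] H))) (hirr : ActsIrreducibly (B : Set (H →L[ℂ] H)))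
    (hU : IsContinuousUnitaryRep U) (hα : InducesAction U B) (hfull : HasFullHilbertSpectrum U B)
    (hQ : ∀ b y, Q (π b y) = π b (Q y)) (hW : ∀ W, IntertwinesOn B π W → Q ∘L W = 0) :
    Q ∘L S = 0 := by
  have := hirr.1
  obtain ⟨x, hx, hx0⟩ := hfull.exists_isFixedVector_ne_zero hU
  refine hirr.eq_zero_of_apply_eq_zero hfull.one_mem hx0 fun b hb => ext_inner_left ℂ fun p => ?_
  let Λ : B →L[ℂ] ℂ :=
    innerSL ℂ p ∘L (Q ∘L S) ∘L ContinuousLinearMap.apply ℂ H x ∘L B.toSubmodule.subtypeL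
  have hΛ : Λ = 0 := hfull.clm_eq_zero hB hα fun n σ T _ hT D hD v => by
    change ⟪p, Q (S ((D : H →L[ℂ] H) ((T v : H →L[ℂ] H) x)))⟫_ℂ = 0
    rw [hS D hD, hQ, hS.map_multiplet_apply_eq_zero hB hirr hU hα hfull hQ hW hT hx, map_zero,
      inner_zero_right]
  exact (DFunLike.congr_fun hΛ ⟨b, hb⟩).trans (inner_zero_right p).symm

end Intertwiners

section Reindexing

variable {H : Type*} [NormedAddCommGroup H] [InnerProductSpace ℂ H] {ι κ : Type*}

open Classical in
variable (H) in
/-- The inclusion of the `i`-th summand into the Hilbert sum of copies of `H`, as an isometry. -/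
def summandInclusion (i : ι) : H →ₗᵢ[ℂ] lp (fun _ : ι => H) 2 where
  toLinearMap := (lp.singleContinuousLinearMap ℂ (fun _ : ι => H) 2 i).toLinearMap
  norm_map' := lp.norm_single (E := fun _ : ι => H) two_pos i

theorem orthogonalFamily_summandInclusion (f : ι ↪ κ) :
    OrthogonalFamily ℂ (fun _ => H) fun i => summandInclusion H (f i) := fun i j hij x y => by
  classical
  refine (lp.inner_single_left (G := fun _ : κ => H) (f i) x _).trans ?_
  exact (congrArg _ (lp.single_apply_ne 2 _ _ (f.injective.ne hij))).trans (inner_zero_right x)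

variable [CompleteSpace H]

theorem linearIsometry_amp_apply {E : Type*} [NormedAddCommGroup E] [InnerProductSpace ℂ E]
    [CompleteSpace E] {V : ι → H →ₗᵢ[ℂ] E} (hV : OrthogonalFamily ℂ (fun _ => H) V)
    {T : H →L[ℂ] H} {T' : E →L[ℂ] E} (h : ∀ i x, V i (T x) = T' (V i x))
    (ξ : lp (fun _ : ι => H) 2) :
    hV.linearIsometry (amp H ι T ξ) = T' (hV.linearIsometry ξ) := by
  refine (hV.hasSum_linearIsometry _).unique ?_
  simpa only [amp_apply, h] using (hV.hasSum_linearIsometry ξ).mapL T'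

/-- The isometry between Hilbert sums of copies of `H` which moves the `i`-th summand to the
`f i`-th one. -/
def reindexLp (f : ι ↪ κ) : lp (fun _ : ι => H) 2 →ₗᵢ[ℂ] lp (fun _ : κ => H) 2 :=
  (orthogonalFamily_summandInclusion f).linearIsometry

open Classical in
theorem reindexLp_single (f : ι ↪ κ) (i : ι) (x : H) :
    reindexLp f (lp.single 2 i x) = lp.single 2 (f i) x :=
  (orthogonalFamily_summandInclusion f).linearIsometry_apply_single x

theorem reindexLp_amp (f : ι ↪ κ) (T : H →L[ℂ] H) (ξ : lp (fun _ : ι => H) 2) :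
    reindexLp f (amp H ι T ξ) = amp H κ T (reindexLp f ξ) :=
  linearIsometry_amp_apply _ (fun i x => by
    classical exact (amp_single T (f i) x).symm) ξ

theorem reindexLp_apply_of_notMem_range {f : ι ↪ κ} {k : κ} (hk : k ∉ Set.range f)
    (ξ : lp (fun _ : ι => H) 2) : reindexLp f ξ k = 0 := by
  classical
  refine (((orthogonalFamily_summandInclusion f).hasSum_linearIsometry ξ).mapL
    (lp.evalCLM ℂ (fun _ : κ => H) 2 k)).unique ?_
  convert! hasSum_zero with i
  exact lp.single_apply_ne (E := fun _ : κ => H) 2 _ _ fun h => hk ⟨i, h.symm⟩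

theorem inner_reindexLp_eq_zero {ι' : Type*} {f : ι ↪ κ} {g : ι' ↪ κ}
    (hfg : Disjoint (Set.range f) (Set.range g)) (ξ : lp (fun _ : ι => H) 2)
    (η : lp (fun _ : ι' => H) 2) : ⟪reindexLp f ξ, reindexLp g η⟫_ℂ = 0 := by
  rw [lp.inner_eq_tsum]
  refine (tsum_congr fun k => ?_).trans tsum_zero
  by_cases hk : k ∈ Set.range f
  · rw [reindexLp_apply_of_notMem_range (hfg.notMem_of_mem_left hk), inner_zero_right]
  · rw [reindexLp_apply_of_notMem_range hk, inner_zero_left]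

theorem mem_range_reindexLp {f : ι ↪ κ} {ξ : lp (fun _ : κ => H) 2}
    (h : ∀ k, ξ k ≠ 0 → k ∈ Set.range f) : ∃ ξ', reindexLp f ξ' = ξ := by
  classical
  have hclosed : IsClosed (Set.range (reindexLp (H := H) f)) :=
    (reindexLp f).isometry.isClosedEmbedding.isClosed_range
  refine hclosed.mem_of_tendsto (lp.hasSum_single (by norm_num) ξ) (.of_forall fun s => ?_)
  refine (LinearMap.range (reindexLp (H := H) f).toLinearMap).sum_mem fun k _ => ?_
  by_cases hk : ξ k = 0
  · rw [hk, lp.single_zero]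
    exact zero_mem _
  · obtain ⟨i, rfl⟩ := h k hk
    exact ⟨_, reindexLp_single f i _⟩

theorem inner_amp_reindexLp (f : ι ↪ κ) (T : H →L[ℂ] H) (ξ : lp (fun _ : κ => H) 2)
    (η : lp (fun _ : ι => H) 2) :
    ⟪ξ, amp H κ T (reindexLp f η)⟫_ℂ =
      ⟪(reindexLp f).toContinuousLinearMap.adjoint ξ, amp H ι T η⟫_ℂ := by
  rw [← reindexLp_amp, ContinuousLinearMap.adjoint_inner_left]
  rfl

theorem inner_reindexLp_amp_reindexLp (f : ι ↪ κ) (T : H →L[ℂ] H) (ξ η : lp (fun _ : ι => H) 2) :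
    ⟪reindexLp f ξ, amp H κ T (reindexLp f η)⟫_ℂ = ⟪ξ, amp H ι T η⟫_ℂ := by
  rw [← reindexLp_amp, LinearIsometry.inner_map_map]

section Disjoint

variable {ι' : Type*} {f : ι ↪ κ} {g : ι' ↪ κ}

theorem inner_amp_reindexLp_add (hfg : Disjoint (Set.range f) (Set.range g)) (T : H →L[ℂ] H)
    (ξ η : lp (fun _ : ι => H) 2) (ξ' η' : lp (fun _ : ι' => H) 2) :
    ⟪reindexLp f ξ + reindexLp g ξ', amp H κ T (reindexLp f η + reindexLp g η')⟫_ℂ =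
      ⟪ξ, amp H ι T η⟫_ℂ + ⟪ξ', amp H ι' T η'⟫_ℂ := by
  simp only [map_add, ← reindexLp_amp, inner_add_left, inner_add_right,
    LinearIsometry.inner_map_map, inner_reindexLp_eq_zero hfg, inner_reindexLp_eq_zero hfg.symm,
    add_zero, zero_add]

theorem norm_amp_reindexLp_add_sq (hfg : Disjoint (Set.range f) (Set.range g)) (T : H →L[ℂ] H)
    (ξ : lp (fun _ : ι => H) 2) (ξ' : lp (fun _ : ι' => H) 2) :
    ‖amp H κ T (reindexLp f ξ + reindexLp g ξ')‖ ^ 2 =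
      ‖amp H ι T ξ‖ ^ 2 + ‖amp H ι' T ξ'‖ ^ 2 := by
  simp only [map_add, ← reindexLp_amp, sq]
  rw [norm_add_sq_eq_norm_sq_add_norm_sq_of_inner_eq_zero _ _
    (inner_reindexLp_eq_zero hfg _ _)]
  simp only [LinearIsometry.norm_map]

end Disjoint

-- Only countably many coordinates of `η` are nonzero.
theorem exists_lp_nat_inner_amp_eq (ξ η : lp (fun _ : ι => H) 2) :
    ∃ ξ' η' : lp (fun _ : ℕ => H) 2, ∀ T : H →L[ℂ] H,
      ⟪ξ, amp H ι T η⟫_ℂ = ⟪ξ', amp H ℕ T η'⟫_ℂ := by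
  obtain ⟨s, hs, hηs⟩ : ∃ s : Set ι, s.Countable ∧ ∀ i, η i ≠ 0 → i ∈ s :=
    ⟨_, ((lp.memℓp η).summable (by norm_num)).countable_support, fun i hi =>
      (Real.rpow_pos_of_pos (norm_pos_iff.2 hi) _).ne'⟩
  obtain ⟨ζ, rfl⟩ := mem_range_reindexLp (f := Function.Embedding.subtype (· ∈ s)) (ξ := η)
    fun i hi => ⟨⟨i, hηs i hi⟩, rfl⟩
  have := hs.to_subtype
  obtain ⟨e, he⟩ := exists_injective_nat s
  exact ⟨reindexLp ⟨e, he⟩ _, reindexLp ⟨e, he⟩ ζ, fun T => by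
    rw [inner_amp_reindexLp, inner_reindexLp_amp_reindexLp]⟩

end Reindexing

section Normality

variable {H : Type*} [NormedAddCommGroup H] [InnerProductSpace ℂ H] [CompleteSpace H]

theorem continuous_ultraweakTopology_iff {X : Type*} {τ : TopologicalSpace X} {f : X → H →L[ℂ] H} :
    Continuous[τ, ultraweakTopology H] f ↔
      ∀ x y : lp (fun _ : ℕ => H) 2, Continuous fun t => ⟪x, amp H ℕ (f t) y⟫_ℂ := by
  simp only [continuous_iInf_rng, continuous_induced_rng, lp.inner_eq_tsum, amp_apply,
    Function.comp_def]

variable {M : Type*} [AddCommGroup M] [Module ℂ M]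

/-- The functional `m ↦ ∑ₙ ⟪xₙ, ρ m yₙ⟫` of a linear map `ρ` into the operators on `H`. -/
def ultraweakFunctional (ρ : M →ₗ[ℂ] (H →L[ℂ] H)) (x y : lp (fun _ : ℕ => H) 2) : M →ₗ[ℂ] ℂ :=
  (innerSL ℂ x ∘L ContinuousLinearMap.apply ℂ _ y).toLinearMap ∘ₗ
    LinearMapClass.linearMap (amp H ℕ) ∘ₗ ρ

theorem ultraweakFunctional_apply (ρ : M →ₗ[ℂ] (H →L[ℂ] H)) (x y : lp (fun _ : ℕ => H) 2) (m : M) :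
    ultraweakFunctional ρ x y m = ⟪x, amp H ℕ (ρ m) y⟫_ℂ := rfl

theorem exists_ultraweakFunctional_eq_add (ρ : M →ₗ[ℂ] (H →L[ℂ] H))
    (x y x' y' : lp (fun _ : ℕ => H) 2) :
    ∃ ξ η, ultraweakFunctional ρ ξ η = ultraweakFunctional ρ x y + ultraweakFunctional ρ x' y' := by
  obtain ⟨ξ, η, h⟩ := exists_lp_nat_inner_amp_eq
    (reindexLp .inl x + reindexLp .inr x' : lp (fun _ : ℕ ⊕ ℕ => H) 2)
    (reindexLp .inl y + reindexLp .inr y')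
  refine ⟨ξ, η, LinearMap.ext fun m => ?_⟩
  rw [ultraweakFunctional_apply, ← h]
  exact inner_amp_reindexLp_add Set.isCompl_range_inl_range_inr.disjoint _ _ _ _ _

theorem exists_ultraweakFunctional_eq {ρ : M →ₗ[ℂ] (H →L[ℂ] H)} {φ : M →ₗ[ℂ] ℂ}
    (hφ : Continuous[.induced ρ (ultraweakTopology H), inferInstance] φ) :
    ∃ ξ η, ultraweakFunctional ρ ξ η = φ := by
  have hspan : φ ∈ Submodule.span ℂ (Set.range fun p : _ × _ => ultraweakFunctional ρ p.1 p.2) := by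
    rw [LinearMap.mem_span_iff_continuous]
    refine continuous_le_dom ?_ hφ
    exact continuous_iff_le_induced.1 (continuous_ultraweakTopology_iff.2 fun x y =>
      continuous_iff_le_induced.2 (iInf_le _ (x, y)))
  clear hφ
  induction hspan using Submodule.span_induction with
  | mem φ h =>
    obtain ⟨p, rfl⟩ := h
    exact ⟨p.1, p.2, rfl⟩
  | zero => exact ⟨0, 0, LinearMap.ext fun m =>
      (ultraweakFunctional_apply ρ 0 0 m).trans (inner_zero_left _)⟩
  | add φ ψ _ _ hφ hψ =>
    obtain ⟨x, y, rfl⟩ := hφ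
    obtain ⟨x', y', rfl⟩ := hψ
    exact exists_ultraweakFunctional_eq_add ρ x y x' y'
  | smul c φ _ hφ =>
    obtain ⟨x, y, rfl⟩ := hφ
    exact ⟨x, c • y, LinearMap.ext fun m => by
      simp only [ultraweakFunctional_apply, map_smul, inner_smul_right, LinearMap.smul_apply,
        smul_eq_mul]⟩

variable {K : Type*} [NormedAddCommGroup K] [InnerProductSpace ℂ K] [CompleteSpace K]
  {A B : NonUnitalStarSubalgebra ℂ (H →L[ℂ] H)} {π : B →⋆ₙₐ[ℂ] (K →L[ℂ] K)}

theorem isNormalOn_iff : IsNormalOn π A ↔ ∀ x y : lp (fun _ : ℕ => K) 2,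
    ∃ ξ η : lp (fun _ : ℕ => H) 2, ∀ b : B, (b : H →L[ℂ] H) ∈ A →
      ⟪x, amp K ℕ (π b) y⟫_ℂ = ⟪ξ, amp H ℕ b η⟫_ℂ := by
  let ι := NonUnitalStarSubalgebraClass.subtype B
  let j : A.comap ι →⋆ₙₐ[ℂ] B := NonUnitalStarSubalgebraClass.subtype _
  refine continuous_ultraweakTopology_iff.trans (forall₂_congr fun x y => ⟨fun h => ?_, ?_⟩)
  · obtain ⟨ξ, η, hξη⟩ := exists_ultraweakFunctional_eq (ρ := LinearMapClass.linearMap (ι.comp j))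
      (φ := ultraweakFunctional (LinearMapClass.linearMap (π.comp j)) x y) h
    exact ⟨ξ, η, fun b hb => (LinearMap.congr_fun hξη (⟨b, hb⟩ : A.comap ι)).symm⟩
  · rintro ⟨ξ, η, hξη⟩
    have hbb : ∀ b : {b : B // (b : H →L[ℂ] H) ∈ A}, ⟪x, amp K ℕ (π b) y⟫_ℂ = ⟪ξ, amp H ℕ b η⟫_ℂ :=
      fun b => hξη b b.2
    simp only [hbb]
    exact continuous_ultraweakTopology_iff.1 continuous_induced_dom ξ η

-- Positivity of `b ↦ ⟪y, π b y⟫` is used through `‖π b y‖² = ⟪y, π (b* b) y⟫ = ⟪b ξ, b η⟫`.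
theorem norm_map_le_of_inner_map_eq {y : K} {ξ η : lp (fun _ : ℕ => H) 2}
    (h : ∀ b : B, (b : H →L[ℂ] H) ∈ A → ⟪y, π b y⟫_ℂ = ⟪ξ, amp H ℕ b η⟫_ℂ) {b : B}
    (hb : (b : H →L[ℂ] H) ∈ A) :
    ‖π b y‖ ≤ ‖amp H (ℕ ⊕ ℕ) b (reindexLp .inl ξ + reindexLp .inr η)‖ := by
  have hinner : ⟪π b y, π b y⟫_ℂ = ⟪amp H ℕ b ξ, amp H ℕ b η⟫_ℂ := by
    rw [inner_map_left, ← mul_apply_eq_comp, ← map_mul, h _ (mul_mem (star_mem hb) hb)]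
    change ⟪ξ, amp H ℕ (star (b : H →L[ℂ] H) * b) η⟫_ℂ = _
    rw [map_mul, map_star, mul_apply_eq_comp, ← inner_star_apply, star_star]
  refine (sq_le_sq₀ (norm_nonneg _) (norm_nonneg _)).1 ?_
  calc ‖π b y‖ ^ 2 = ‖⟪π b y, π b y⟫_ℂ‖ := by
        rw [inner_self_eq_norm_sq_to_K, norm_pow, norm_algebraMap', norm_norm]
    _ ≤ ‖amp H ℕ b ξ‖ * ‖amp H ℕ b η‖ := hinner ▸ norm_inner_le_norm _ _
    _ ≤ ‖amp H ℕ b ξ‖ ^ 2 + ‖amp H ℕ b η‖ ^ 2 := by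
        nlinarith [sq_nonneg (‖amp H ℕ b ξ‖ - ‖amp H ℕ b η‖), sq_nonneg ‖amp H ℕ b ξ‖,
          sq_nonneg ‖amp H ℕ b η‖]
    _ = _ := (norm_amp_reindexLp_add_sq Set.isCompl_range_inl_range_inr.disjoint _ _ _).symm

theorem map_eq_zero_of_inner_map_eq (h1B : 1 ∈ B) (h1A : 1 ∈ A) {y : K} (hy : π ⟨1, h1B⟩ y = y)
    {ξ η : lp (fun _ : ℕ => H) 2}
    (h : ∀ b : B, (b : H →L[ℂ] H) ∈ A → ⟪y, π b y⟫_ℂ = ⟪ξ, amp H ℕ b η⟫_ℂ) {Q : K →L[ℂ] K}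
    (hQ : ∀ S, IntertwinesOn A π S → Q ∘L S = 0) : Q y = 0 := by
  classical
  let ι := NonUnitalStarSubalgebraClass.subtype B
  let j : A.comap ι →⋆ₙₐ[ℂ] B := NonUnitalStarSubalgebraClass.subtype _
  obtain ⟨V, hV, rfl⟩ := exists_intertwiner_of_norm_le (θ := ((amp H (ℕ ⊕ ℕ)).comp ι).comp j)
    (π := π.comp j) (ζ := reindexLp .inl ξ + reindexLp .inr η) (C := 1)
    (fun b => (norm_map_le_of_inner_map_eq h b.2).trans_eq (one_mul _).symm)
    ⟨⟨⟨1, h1B⟩, h1A⟩, rfl, hy⟩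
  have hQV : Q ∘L V = 0 := lp.ext_continuousLinearMap (by norm_num) fun i =>
    hQ (V ∘L lp.singleContinuousLinearMap ℂ (fun _ => H) 2 i) fun b hb x => by
      change V (lp.single 2 i ((b : H →L[ℂ] H) x)) = π b (V (lp.single 2 i x))
      rw [← amp_single]
      exact hV ⟨b, hb⟩ _
  exact DFunLike.congr_fun hQV _

end Normality

section Decomposition

variable {H : Type*} [NormedAddCommGroup H] [InnerProductSpace ℂ H] [CompleteSpace H]
  {K : Type u} [NormedAddCommGroup K] [InnerProductSpace ℂ K] [CompleteSpace K]
  {B : NonUnitalStarSubalgebra ℂ (H →L[ℂ] H)} {π : B →⋆ₙₐ[ℂ] (K →L[ℂ] K)} {W W' : H →L[ℂ] K}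
  {Ω : H}

theorem IntertwinesOn.inner_eq (hW : IntertwinesOn B π W) (hW' : IntertwinesOn B π W')
    (hirr : ActsIrreducibly (B : Set (H →L[ℂ] H))) (hΩ : ‖Ω‖ = 1) (x y : H) :
    ⟪W x, W' y⟫_ℂ = ⟪W Ω, W' Ω⟫_ℂ * ⟪x, y⟫_ℂ := by
  obtain ⟨c, hc⟩ := hirr.exists_eq_smul_one (fun _ => star_mem) fun b hb =>
    hW.commute_adjoint_comp hW' (D := ⟨b, hb⟩) hb
  have hinner : ∀ x y, ⟪W x, W' y⟫_ℂ = c * ⟪x, y⟫_ℂ := fun x y => by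
    rw [← ContinuousLinearMap.adjoint_inner_right, ← ContinuousLinearMap.comp_apply, hc, smul_apply,
      one_apply_eq_self, inner_smul_right]
  rw [hinner, hinner, inner_self_eq_norm_sq_to_K, hΩ, RCLike.ofReal_one, one_pow, mul_one]

theorem IntertwinesOn.norm_apply (hW : IntertwinesOn B π W)
    (hirr : ActsIrreducibly (B : Set (H →L[ℂ] H))) (hΩ : ‖Ω‖ = 1) (x : H) :
    ‖W x‖ = ‖W Ω‖ * ‖x‖ := by
  have h := hW.inner_eq hW hirr hΩ x x
  simp only [inner_self_eq_norm_sq_to_K, ← mul_pow] at h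
  exact (pow_left_inj₀ (norm_nonneg _) (by positivity) two_ne_zero).1 (by exact_mod_cast h)

/-- The vectors of `K` which correspond to `Ω` under an intertwiner from the identical
representation of `B` to `π`; for irreducible `B`, it parametrizes these intertwiners. -/
def intertwinerSubspace (π : B →⋆ₙₐ[ℂ] (K →L[ℂ] K)) (Ω : H) : Submodule ℂ K where
  carrier := {y | ∃ W, IntertwinesOn B π W ∧ W Ω = y}
  add_mem' := by
    rintro _ _ ⟨V, hV, rfl⟩ ⟨W, hW, rfl⟩
    exact ⟨V + W, fun b hb x => by simp only [add_apply, hV b hb, hW b hb, map_add], rfl⟩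
  zero_mem' := ⟨0, fun b _ _ => (map_zero (π b)).symm, rfl⟩
  smul_mem' := by
    rintro c _ ⟨W, hW, rfl⟩
    exact ⟨c • W, fun b hb x => by simp only [smul_apply, hW b hb, map_smul], rfl⟩

theorem mem_intertwinerSubspace_iff (hirr : ActsIrreducibly (B : Set (H →L[ℂ] H))) (h1 : 1 ∈ B)
    (hΩ : ‖Ω‖ = 1) {y : K} : y ∈ intertwinerSubspace π Ω ↔
      π ⟨1, h1⟩ y = y ∧ ∀ b : B, ‖π b y‖ ≤ ‖y‖ * ‖(b : H →L[ℂ] H) Ω‖ := by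
  constructor
  · rintro ⟨W, hW, rfl⟩
    exact ⟨(hW ⟨1, h1⟩ h1 Ω).symm, fun b => by rw [← hW b b.2, hW.norm_apply hirr hΩ]⟩
  · rintro ⟨hy, hb⟩
    obtain ⟨W, hW, hWΩ⟩ := exists_intertwiner_of_norm_le
      (θ := NonUnitalStarSubalgebraClass.subtype B) hb ⟨⟨1, h1⟩, rfl, hy⟩
    exact ⟨W, fun b _ => hW b, hWΩ⟩

theorem isClosed_intertwinerSubspace (hirr : ActsIrreducibly (B : Set (H →L[ℂ] H))) (h1 : 1 ∈ B)
    (hΩ : ‖Ω‖ = 1) : IsClosed (intertwinerSubspace π Ω : Set K) := by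
  have hset : (intertwinerSubspace π Ω : Set K) =
      {y | π ⟨1, h1⟩ y = y} ∩ ⋂ b : B, {y | ‖π b y‖ ≤ ‖y‖ * ‖(b : H →L[ℂ] H) Ω‖} := by
    ext y
    simp only [SetLike.mem_coe, mem_intertwinerSubspace_iff hirr h1 hΩ, Set.mem_inter_iff,
      Set.mem_iInter, Set.mem_ofPred_eq]
  rw [hset]
  exact (isClosed_eq (by fun_prop) (by fun_prop)).inter
    (isClosed_iInter fun b => isClosed_le (by fun_prop) (by fun_prop))

theorem exists_isometric_intertwiner (hirr : ActsIrreducibly (B : Set (H →L[ℂ] H))) (h1 : 1 ∈ B)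
    (π : B →⋆ₙₐ[ℂ] (K →L[ℂ] K)) :
    ∃ (J : Type u) (V : lp (fun _ : J => H) 2 →ₗᵢ[ℂ] K),
      (∀ (b : B) ξ, V (amp H J b ξ) = π b (V ξ)) ∧
      ∀ W, IntertwinesOn B π W → (∀ ξ x, ⟪V ξ, W x⟫_ℂ = 0) → W = 0 := by
  classical
  have := hirr.1
  obtain ⟨Ω, hΩ⟩ := exists_norm_eq H zero_le_one
  have := (isClosed_intertwinerSubspace (π := π) hirr h1 hΩ).completeSpace_coe
  obtain ⟨J, e, -⟩ := exists_hilbertBasis ℂ (intertwinerSubspace π Ω)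
  choose W hW hWΩ using fun j : J => (e j).2
  let V₀ : J → H →ₗᵢ[ℂ] K := fun j =>
    { toLinearMap := (W j).toLinearMap
      norm_map' := fun x => ((hW j).norm_apply hirr hΩ x).trans (by
        rw [hWΩ, Submodule.norm_coe, e.orthonormal.1 j, one_mul]) }
  have hV₀ : OrthogonalFamily ℂ (fun _ : J => H) V₀ := fun i j hij x y =>
    ((hW i).inner_eq (hW j) hirr hΩ x y).trans (by
      rw [hWΩ, hWΩ, ← Submodule.coe_inner, e.orthonormal.2 hij, zero_mul])
  refine ⟨J, hV₀.linearIsometry, fun b ξ => linearIsometry_amp_apply hV₀ (fun j => hW j b b.2) ξ,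
    fun W' hW' horth => ?_⟩
  have hcoord : (⟨W' Ω, W', hW', rfl⟩ : intertwinerSubspace π Ω) = 0 := by
    refine e.repr.injective (lp.ext (funext fun j => ?_))
    rw [e.repr_apply_apply, map_zero, Submodule.coe_inner, ← hWΩ]
    exact (congrArg (⟪·, _⟫_ℂ) (hV₀.linearIsometry_apply_single Ω).symm).trans (horth _ _)
  have hzero : W' Ω = 0 := congrArg Subtype.val hcoord
  exact ContinuousLinearMap.ext fun x => norm_eq_zero.1 <| by
    rw [hW'.norm_apply hirr hΩ, hzero, norm_zero, zero_mul]

theorem adjoint_map_apply {J : Type*} {V : lp (fun _ : J => H) 2 →L[ℂ] K}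
    (hV : ∀ (b : B) ξ, V (amp H J b ξ) = π b (V ξ)) (b : B) (z : K) :
    V.adjoint (π b z) = amp H J b (V.adjoint z) := by
  refine ext_inner_left ℂ fun ξ => ?_
  have hstar : V (star (amp H J b) ξ) = π (star b) (V ξ) := by
    rw [← map_star]
    exact hV (star b) ξ
  rw [← inner_star_apply, ContinuousLinearMap.adjoint_inner_right,
    ContinuousLinearMap.adjoint_inner_right, hstar, inner_map_left, star_star]

theorem apply_adjoint_apply_eq_self (h1 : 1 ∈ B) {J : Type*} {V : lp (fun _ : J => H) 2 →ₗᵢ[ℂ] K}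
    (hV : ∀ (b : B) ξ, V (amp H J b ξ) = π b (V ξ))
    (hmax : ∀ W, IntertwinesOn B π W → (∀ ξ x, ⟪V ξ, W x⟫_ℂ = 0) → W = 0)
    (htotal : ∀ Q : K →L[ℂ] K, (∀ b y, Q (π b y) = π b (Q y)) →
      (∀ W, IntertwinesOn B π W → Q ∘L W = 0) → ∀ y, π ⟨1, h1⟩ y = y → Q y = 0)
    {y : K} (hy : π ⟨1, h1⟩ y = y) : V (V.toContinuousLinearMap.adjoint y) = y := by
  let Q : K →L[ℂ] K := 1 - V.toContinuousLinearMap ∘L V.toContinuousLinearMap.adjoint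
  have hQapply : ∀ z, Q z = z - V (V.toContinuousLinearMap.adjoint z) := fun _ => rfl
  have hQ : ∀ b z, Q (π b z) = π b (Q z) := fun b z => by
    rw [hQapply, hQapply, adjoint_map_apply hV, hV, map_sub]
  have horth : ∀ ξ z, ⟪V ξ, Q z⟫_ℂ = 0 := fun ξ z => by
    rw [hQapply, inner_sub_right, V.inner_map_map, ContinuousLinearMap.adjoint_inner_right]
    exact sub_self _
  have hQW : ∀ W, IntertwinesOn B π W → Q ∘L W = 0 := fun W hW =>
    hmax _ (fun b hb z => by
      rw [ContinuousLinearMap.comp_apply, ContinuousLinearMap.comp_apply, hW b hb, hQ])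
      fun ξ z => horth ξ (W z)
  exact (sub_eq_zero.1 (htotal Q hQ hQW y hy)).symm

theorem exists_inner_map_eq (hirr : ActsIrreducibly (B : Set (H →L[ℂ] H))) (h1 : 1 ∈ B)
    (htotal : ∀ Q : K →L[ℂ] K, (∀ b y, Q (π b y) = π b (Q y)) →
      (∀ W, IntertwinesOn B π W → Q ∘L W = 0) → ∀ y, π ⟨1, h1⟩ y = y → Q y = 0) (x y : K) :
    ∃ ξ η : lp (fun _ : ℕ => H) 2, ∀ b : B, ⟪x, π b y⟫_ℂ = ⟪ξ, amp H ℕ b η⟫_ℂ := by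
  obtain ⟨J, V, hV, hmax⟩ := exists_isometric_intertwiner hirr h1 π
  have hmul : ∀ b, π b (π ⟨1, h1⟩ y) = π b y := fun b => by
    rw [← mul_apply_eq_comp, ← map_mul]
    exact congrArg (fun c => π c y) (Subtype.ext (mul_one _))
  obtain ⟨ξ, η, hξη⟩ := exists_lp_nat_inner_amp_eq (V.toContinuousLinearMap.adjoint x)
    (V.toContinuousLinearMap.adjoint (π ⟨1, h1⟩ y))
  refine ⟨ξ, η, fun b => ?_⟩
  rw [← hξη, ContinuousLinearMap.adjoint_inner_left, LinearIsometry.coe_toContinuousLinearMap, hV,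
    apply_adjoint_apply_eq_self h1 hV hmax htotal (hmul _), hmul]

end Decomposition

end

theorem theoremA6 {G : Type*} [Group G] [TopologicalSpace G] [IsTopologicalGroup G]
    [CompactSpace G] [T2Space G]
    {H : Type*} [NormedAddCommGroup H] [InnerProductSpace ℂ H] [CompleteSpace H]
    (B : NonUnitalStarSubalgebra ℂ (H →L[ℂ] H)) (hB : IsClosed (B : Set (H →L[ℂ] H)))
    (hirr : ActsIrreducibly (B : Set (H →L[ℂ] H)))
    (U : G →* unitary (H →L[ℂ] H)) (hU : IsContinuousUnitaryRep U)
    (hα : InducesAction U B) (hfull : HasFullHilbertSpectrum U B)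
    {K : Type*} [NormedAddCommGroup K] [InnerProductSpace ℂ K] [CompleteSpace K]
    (π : B →⋆ₙₐ[ℂ] (K →L[ℂ] K)) (hπ : IsNormalOn π (fixedPointAlgebra U B)) :
    IsNormalOn π B := by
  have h1 := hfull.one_mem_fixedPointAlgebra
  refine isNormalOn_iff.2 fun x y => ?_
  obtain ⟨ξ, η, hξη⟩ := exists_inner_map_eq (π := (amp K ℕ).comp π) hirr hfull.one_mem
    (fun Q hQ hW z hz => by
      obtain ⟨ξ, η, hξη⟩ := isNormalOn_iff.1 hπ z z
      exact map_eq_zero_of_inner_map_eq hfull.one_mem h1 hz hξη fun S hS =>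
        hS.comp_eq_zero hB hirr hU hα hfull hQ hW) x y
  exact ⟨ξ, η, fun b _ => hξη b⟩
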